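/- Work over the field $\mathbb{C}$. A quasi-bialgebra is a unital associative algebra $H$ with unital algebra homomorphisms $\Delta:H\to H\otimes H$, $\varepsilon:H\to\mathbb{C}$ and an invertible element $\Phi\in H^{\otimes 3}$ such that $(\mathrm{id}\otimes\Delta)(\Delta(h))\,\Phi=\Phi\,(\Delta\otimes\mathrm{id})(\Delta(h))$ for all $h\in H$, $(\mathrm{id}\otimes\mathrm{id}\otimes\Delta)(\Phi)\,(\Delta\otimes\mathrm{id}\otimes\mathrm{id})(\Phi)=(1\otimes\Phi)\,(\mathrm{id}\otimes\Delta\otimes\mathrm{id})(\Phi)\,(\Phi\otimes 1)$, $(\varepsilon\otimes\mathrm{id})\Delta=\mathrm{id}=(\mathrm{id}\otimes\varepsilon)\Delta$ and $(\mathrm{id}\otimes\varepsilon\otimes\mathrm{id})(\Phi)=1$. A twist for $H$ is an invertible $J\in H\otimes H$ with $(\varepsilon\otimes\mathrm{id})(J)=1=(\mathrm{id}\otimes\varepsilon)(J)$; it defines the quasi-bialgebra $H^J=(H,\Delta^J,\varepsilon,\Phi^J)$ with $\Delta^J(h)=J^{-1}\Delta(h)J$ and $\Phi^J=(1\otimes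 J)^{-1}(\mathrm{id}\otimes\Delta)(J)^{-1}\,\Phi\,(\Delta\otimes\mathrm{id})(J)\,(J\otimes 1)$. Two quasi-bialgebras $H_1,H_2$ are twist equivalent if $H_2$ is isomorphic, as a quasi-bialgebra, to $H_1^J$ for some twist $J$ for $H_1$. $\mathrm{Rep}(H)$ denotes the $\mathbb{C}$-linear monoidal category of finite-dimensional representations of $H$, in which $h\in H$ acts on $V\otimes W$ by $\Delta(h)$, the unit object is $\mathbb{C}$ with action $\varepsilon$, the associativity isomorphism $(U\otimes V)\otimes W\to U\otimes(V\otimes W)$ is the action of $\Phi$, and the unit isomorphisms are the usual ones. $\mathrm{Rep}(H_1)$ and $\mathrm{Rep}(H_2)$ are tensor equivalent if there is a $\mathbb{C}$-linear (strong) monoidal functor $\mathrm{Rep}(H_1)\to\mathrm{Rep}(H_2)$ which is an equivalence of categories. **Theorem.** Two finite-dimensional quasi-bialgebras $H_1,H_2$ over $\mathbb{C}$ are twist equivalent if and only if the categories $\mathrm{Rep}(H_1)$ and $\mathrm{Rep}(H_2)$ are tensor equivalent. -/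

import Mathlib

open scoped TensorProduct
open CategoryTheory

universe u v

/-- A quasi-bialgebra over a field `k` (Drinfeld): a unital associative `k`-algebra `H` with
unital algebra homomorphisms `Δ : H → H ⊗ H`, `ε : H → k` and an invertible element
`Φ ∈ H ⊗ H ⊗ H` such that
`(id ⊗ Δ)(Δ h) Φ = Φ (Δ ⊗ id)(Δ h)`,
`(id ⊗ id ⊗ Δ)(Φ) (Δ ⊗ id ⊗ id)(Φ) = (1 ⊗ Φ) (id ⊗ Δ ⊗ id)(Φ) (Φ ⊗ 1)`,
`(ε ⊗ id) Δ = id = (id ⊗ ε) Δ` and `(id ⊗ ε ⊗ id)(Φ) = 1`.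
All iterated tensor powers are bracketed to the right. -/
class QuasiBialgebra (k : Type u) (H : Type v) [Field k] [Ring H] [Algebra k H] where
  /-- the comultiplication `Δ` -/
  comul : H →ₐ[k] H ⊗[k] H
  /-- the counit `ε` -/
  counit : H →ₐ[k] k
  /-- the associator `Φ` -/
  assoc : (H ⊗[k] (H ⊗[k] H))ˣ
  quasi_coassoc : ∀ h : H,
    Algebra.TensorProduct.map (AlgHom.id k H) comul (comul h) * (assoc : H ⊗[k] (H ⊗[k] H)) =
      (assoc : H ⊗[k] (H ⊗[k] H)) *
        Algebra.TensorProduct.assoc k k k H H H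
          (Algebra.TensorProduct.map comul (AlgHom.id k H) (comul h))
  pentagon :
    Algebra.TensorProduct.map (AlgHom.id k H) (Algebra.TensorProduct.map (AlgHom.id k H) comul)
        (assoc : H ⊗[k] (H ⊗[k] H)) *
      Algebra.TensorProduct.assoc k k k H H (H ⊗[k] H)
        (Algebra.TensorProduct.map comul (AlgHom.id k (H ⊗[k] H))
          (assoc : H ⊗[k] (H ⊗[k] H))) =
    ((1 : H) ⊗ₜ[k] (assoc : H ⊗[k] (H ⊗[k] H))) *
      Algebra.TensorProduct.map (AlgHom.id k H)
        ((Algebra.TensorProduct.assoc k k k H H H : (H ⊗[k] H) ⊗[k] H →ₐ[k] H ⊗[k] (H ⊗[k] H)).comp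
          (Algebra.TensorProduct.map comul (AlgHom.id k H)))
        (assoc : H ⊗[k] (H ⊗[k] H)) *
      Algebra.TensorProduct.map (AlgHom.id k H)
        (Algebra.TensorProduct.map (AlgHom.id k H)
          (Algebra.TensorProduct.includeLeft : H →ₐ[k] H ⊗[k] H))
        (assoc : H ⊗[k] (H ⊗[k] H))
  counit_left : ∀ h : H,
    Algebra.TensorProduct.lid k H
      (Algebra.TensorProduct.map counit (AlgHom.id k H) (comul h)) = h
  counit_right : ∀ h : H,
    Algebra.TensorProduct.rid k k H
      (Algebra.TensorProduct.map (AlgHom.id k H) counit (comul h)) = h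
  counit_assoc :
    Algebra.TensorProduct.map (AlgHom.id k H)
      (((Algebra.TensorProduct.lid k H : k ⊗[k] H ≃ₐ[k] H) : k ⊗[k] H →ₐ[k] H).comp
        (Algebra.TensorProduct.map counit (AlgHom.id k H)))
      (assoc : H ⊗[k] (H ⊗[k] H)) = 1

namespace QuasiBialgebra

variable (k : Type u) [Field k]

section Twist

variable {H : Type v} [Ring H] [Algebra k H] [QuasiBialgebra k H]

/-- A twist for the quasi-bialgebra `H`: an invertible `J ∈ H ⊗ H` with
`(ε ⊗ id)(J) = 1 = (id ⊗ ε)(J)`. -/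
def IsTwist (J : (H ⊗[k] H)ˣ) : Prop :=
  Algebra.TensorProduct.lid k H
      (Algebra.TensorProduct.map (counit (k := k) (H := H)) (AlgHom.id k H)
        (J : H ⊗[k] H)) = 1 ∧
  Algebra.TensorProduct.rid k k H
      (Algebra.TensorProduct.map (AlgHom.id k H) (counit (k := k) (H := H))
        (J : H ⊗[k] H)) = 1

variable {k}

/-- The twisted comultiplication `Δ^J(h) = J⁻¹ Δ(h) J`. -/
def twistComul (J : (H ⊗[k] H)ˣ) (h : H) : H ⊗[k] H :=
  (↑J⁻¹ : H ⊗[k] H) * comul (k := k) h * (J : H ⊗[k] H)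

/-- The twisted associator
`Φ^J = (1 ⊗ J)⁻¹ (id ⊗ Δ)(J)⁻¹ Φ (Δ ⊗ id)(J) (J ⊗ 1)`. -/
def twistAssoc (J : (H ⊗[k] H)ˣ) : H ⊗[k] (H ⊗[k] H) :=
  ((1 : H) ⊗ₜ[k] (↑J⁻¹ : H ⊗[k] H)) *
    Algebra.TensorProduct.map (AlgHom.id k H) (comul (k := k) (H := H)) (↑J⁻¹ : H ⊗[k] H) *
    (assoc (k := k) (H := H) : H ⊗[k] (H ⊗[k] H)) *
    Algebra.TensorProduct.assoc k k k H H H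
      (Algebra.TensorProduct.map (comul (k := k) (H := H)) (AlgHom.id k H) (J : H ⊗[k] H)) *
    Algebra.TensorProduct.assoc k k k H H H ((J : H ⊗[k] H) ⊗ₜ[k] (1 : H))

end Twist

/-- `H₁` and `H₂` are twist equivalent: for some twist `J` of `H₁`, there is an isomorphism of
quasi-bialgebras from `H₂` to the twisted quasi-bialgebra `H₁^J = (H₁, Δ^J, ε, Φ^J)`, that is,
an algebra isomorphism compatible with comultiplications, counits and associators. -/
def TwistEquivalent (H₁ H₂ : Type*) [Ring H₁] [Algebra k H₁] [QuasiBialgebra k H₁]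
    [Ring H₂] [Algebra k H₂] [QuasiBialgebra k H₂] : Prop :=
  ∃ (J : (H₁ ⊗[k] H₁)ˣ) (φ : H₂ ≃ₐ[k] H₁), IsTwist k J ∧
    (∀ h : H₂, Algebra.TensorProduct.map (φ : H₂ →ₐ[k] H₁) (φ : H₂ →ₐ[k] H₁)
      (comul (k := k) h) = twistComul J (φ h)) ∧
    (∀ h : H₂, counit (k := k) (φ h) = counit (k := k) h) ∧
    Algebra.TensorProduct.map (φ : H₂ →ₐ[k] H₁)
      (Algebra.TensorProduct.map (φ : H₂ →ₐ[k] H₁) (φ : H₂ →ₐ[k] H₁))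
      (assoc (k := k) (H := H₂) : H₂ ⊗[k] (H₂ ⊗[k] H₂)) = twistAssoc J

end QuasiBialgebra

/-- A finite-dimensional representation of the `k`-algebra `H`. The underlying space lives in the
universe of `k`; every finite-dimensional representation is isomorphic to one of this kind. -/
structure FDRepr (k : Type u) (H : Type v) [Field k] [Ring H] [Algebra k H] where
  /-- the underlying vector space -/
  V : Type u
  [addCommGroup : AddCommGroup V]
  [module : Module k V]
  [finite : FiniteDimensional k V]
  /-- the action of `H` -/
  ρ : H →ₐ[k] Module.End k V

attribute [instance] FDRepr.addCommGroup FDRepr.module FDRepr.finite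

namespace FDRepr

section Category

variable {k : Type u} {H : Type v} [Field k] [Ring H] [Algebra k H]

/-- A morphism of representations: an `H`-equivariant linear map. -/
@[ext]
structure Hom (X Y : FDRepr k H) where
  /-- the underlying linear map -/
  lin : X.V →ₗ[k] Y.V
  comm : ∀ h : H, lin ∘ₗ X.ρ h = Y.ρ h ∘ₗ lin

/-- The category `Rep(H)` of finite-dimensional representations of `H`. -/
instance : Category (FDRepr k H) where
  Hom X Y := Hom X Y
  id X := ⟨LinearMap.id, fun _ => rfl⟩
  comp f g := ⟨g.lin ∘ₗ f.lin, fun h => by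
    rw [LinearMap.comp_assoc, f.comm, ← LinearMap.comp_assoc, g.comm, LinearMap.comp_assoc]⟩

@[ext]
theorem hom_ext {X Y : FDRepr k H} {f g : X ⟶ Y} (h : f.lin = g.lin) : f = g := Hom.ext h

@[simp] theorem id_lin (X : FDRepr k H) : Hom.lin (𝟙 X) = LinearMap.id := rfl

@[simp] theorem comp_lin {X Y Z : FDRepr k H} (f : X ⟶ Y) (g : Y ⟶ Z) :
    Hom.lin (f ≫ g) = g.lin ∘ₗ f.lin := rfl

instance (X Y : FDRepr k H) : Zero (X ⟶ Y) := ⟨⟨0, fun h => by simp⟩⟩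

instance (X Y : FDRepr k H) : Add (X ⟶ Y) :=
  ⟨fun f g => ⟨f.lin + g.lin, fun h => by
    rw [LinearMap.add_comp, LinearMap.comp_add, f.comm, g.comm]⟩⟩

instance (X Y : FDRepr k H) : Neg (X ⟶ Y) :=
  ⟨fun f => ⟨-f.lin, fun h => by rw [LinearMap.neg_comp, LinearMap.comp_neg, f.comm]⟩⟩

instance (X Y : FDRepr k H) : SMul k (X ⟶ Y) :=
  ⟨fun c f => ⟨c • f.lin, fun h => by rw [LinearMap.smul_comp, LinearMap.comp_smul, f.comm]⟩⟩

@[simp] theorem zero_lin (X Y : FDRepr k H) : Hom.lin (0 : X ⟶ Y) = 0 := rfl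
@[simp] theorem add_lin {X Y : FDRepr k H} (f g : X ⟶ Y) :
    Hom.lin (f + g) = f.lin + g.lin := rfl
@[simp] theorem neg_lin {X Y : FDRepr k H} (f : X ⟶ Y) : Hom.lin (-f) = -f.lin := rfl
@[simp] theorem smul_lin {X Y : FDRepr k H} (c : k) (f : X ⟶ Y) :
    Hom.lin (c • f) = c • f.lin := rfl

instance (X Y : FDRepr k H) : AddCommGroup (X ⟶ Y) where
  add_assoc f g h := by ext1; simp [add_assoc]
  zero_add f := by ext1; simp
  add_zero f := by ext1; simp
  add_comm f g := by ext1; simp [add_comm]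
  neg_add_cancel f := by ext1; simp
  nsmul := nsmulRec
  zsmul := zsmulRec

instance (X Y : FDRepr k H) : Module k (X ⟶ Y) where
  one_smul f := by ext1; simp
  mul_smul a b f := by ext1; simp [mul_smul]
  smul_zero a := by ext1; simp
  smul_add a f g := by ext1; simp
  add_smul a b f := by ext1; simp [add_smul]
  zero_smul f := by ext1; simp

/-- `Rep(H)` is a `k`-linear category. -/
instance : Preadditive (FDRepr k H) where
  add_comp X Y Z f g h := by ext1; simp [LinearMap.comp_add]
  comp_add X Y Z f g h := by ext1; simp [LinearMap.add_comp]

instance : Linear k (FDRepr k H) where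
  smul_comp X Y Z r f g := by ext1; simp [LinearMap.comp_smul]
  comp_smul X Y Z f r g := by ext1; simp [LinearMap.smul_comp]

/-- An equivariant linear isomorphism is an isomorphism in `Rep(H)`. -/
def mkIso {X Y : FDRepr k H} (e : X.V ≃ₗ[k] Y.V)
    (he : ∀ h : H, e.toLinearMap ∘ₗ X.ρ h = Y.ρ h ∘ₗ e.toLinearMap) : X ≅ Y where
  hom := ⟨e.toLinearMap, he⟩
  inv := ⟨e.symm.toLinearMap, fun h => by
    ext y
    obtain ⟨x, rfl⟩ := e.surjective y
    have := LinearMap.congr_fun (he h) x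
    simp only [LinearMap.comp_apply, LinearEquiv.coe_coe] at this
    simp [← this]⟩
  hom_inv_id := by ext1; ext x; simp
  inv_hom_id := by ext1; ext x; simp

@[simp] theorem mkIso_hom_lin {X Y : FDRepr k H} (e : X.V ≃ₗ[k] Y.V)
    (he : ∀ h : H, e.toLinearMap ∘ₗ X.ρ h = Y.ρ h ∘ₗ e.toLinearMap) :
    Hom.lin (mkIso e he).hom = e.toLinearMap := rfl

end Category

section TensorAction

variable {k : Type u} [Field k]
variable {A B C A' B' : Type*} [Ring A] [Algebra k A] [Ring B] [Algebra k B] [Ring C] [Algebra k C]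
  [Ring A'] [Algebra k A'] [Ring B'] [Algebra k B']
variable {V W U V' W' : Type*} [AddCommGroup V] [Module k V] [AddCommGroup W] [Module k W]
  [AddCommGroup U] [Module k U] [AddCommGroup V'] [Module k V'] [AddCommGroup W'] [Module k W']

/-- The action of `A ⊗ B` on `V ⊗ W`: `(a ⊗ b)(v ⊗ w) = a v ⊗ b w`. -/
noncomputable def tensorAction (ρ : A →ₐ[k] Module.End k V) (σ : B →ₐ[k] Module.End k W) :
    A ⊗[k] B →ₐ[k] Module.End k (V ⊗[k] W) :=
  (Module.endTensorEndAlgHom (R := k) (S := k) (A := k) (M := V) (N := W)).comp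
    (Algebra.TensorProduct.map ρ σ)

@[simp] theorem tensorAction_tmul (ρ : A →ₐ[k] Module.End k V) (σ : B →ₐ[k] Module.End k W)
    (a : A) (b : B) : tensorAction ρ σ (a ⊗ₜ b) = TensorProduct.map (ρ a) (σ b) := rfl

theorem tensorAction_map (ρ : A →ₐ[k] Module.End k V) (σ : B →ₐ[k] Module.End k W)
    (f : A' →ₐ[k] A) (g : B' →ₐ[k] B) (x : A' ⊗[k] B') :
    tensorAction ρ σ (Algebra.TensorProduct.map f g x) =
      tensorAction (ρ.comp f) (σ.comp g) x := by
  induction x with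
  | zero => simp
  | tmul a b => simp
  | add x y hx hy => simp [hx, hy]

theorem tensorAction_assoc (ρ : A →ₐ[k] Module.End k V) (σ : B →ₐ[k] Module.End k W)
    (τ : C →ₐ[k] Module.End k U) (x : (A ⊗[k] B) ⊗[k] C) :
    (TensorProduct.assoc k V W U).toLinearMap ∘ₗ tensorAction (tensorAction ρ σ) τ x =
      tensorAction ρ (tensorAction σ τ) (Algebra.TensorProduct.assoc k k k A B C x) ∘ₗ
        (TensorProduct.assoc k V W U).toLinearMap := by
  induction x with
  | zero => simp
  | add x y hx hy => simp [LinearMap.comp_add, LinearMap.add_comp, hx, hy]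
  | tmul x c =>
    induction x with
    | zero => simp
    | add x y hx hy =>
      rw [TensorProduct.add_tmul, map_add, map_add, map_add, LinearMap.comp_add,
        LinearMap.add_comp, hx, hy]
    | tmul a b =>
      ext v w u
      simp

/-- Naturality of the tensor action. -/
theorem map_comp_tensorAction {ρ : A →ₐ[k] Module.End k V} {σ : B →ₐ[k] Module.End k W}
    {ρ' : A →ₐ[k] Module.End k V'} {σ' : B →ₐ[k] Module.End k W'}
    (f : V →ₗ[k] V') (g : W →ₗ[k] W') (hf : ∀ a, f ∘ₗ ρ a = ρ' a ∘ₗ f)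
    (hg : ∀ b, g ∘ₗ σ b = σ' b ∘ₗ g) (x : A ⊗[k] B) :
    TensorProduct.map f g ∘ₗ tensorAction ρ σ x =
      tensorAction ρ' σ' x ∘ₗ TensorProduct.map f g := by
  induction x with
  | zero => simp
  | add x y hx hy => simp [LinearMap.comp_add, LinearMap.add_comp, hx, hy]
  | tmul a b => simp [← TensorProduct.map_comp, hf, hg]

end TensorAction

section Coherence

open QuasiBialgebra

variable {k : Type u} {H : Type v} [Field k] [Ring H] [Algebra k H]
variable {V W U X : Type*} [AddCommGroup V] [Module k V] [AddCommGroup W] [Module k W]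
  [AddCommGroup U] [Module k U] [AddCommGroup X] [Module k X]

theorem lid_comp_tensorAction (ε : H →ₐ[k] k) (ρ : H →ₐ[k] Module.End k V) (x : H ⊗[k] H) :
    (TensorProduct.lid k V).toLinearMap ∘ₗ
        tensorAction ((Algebra.ofId k (Module.End k k)).comp ε) ρ x =
      ρ (Algebra.TensorProduct.lid k H (Algebra.TensorProduct.map ε (AlgHom.id k H) x)) ∘ₗ
        (TensorProduct.lid k V).toLinearMap := by
  induction x with
  | zero => simp
  | add x y hx hy => simp only [map_add, LinearMap.comp_add, LinearMap.add_comp, hx, hy]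
  | tmul a b =>
    ext v
    simp [Algebra.ofId_apply]

theorem rid_comp_tensorAction (ε : H →ₐ[k] k) (ρ : H →ₐ[k] Module.End k V) (x : H ⊗[k] H) :
    (TensorProduct.rid k V).toLinearMap ∘ₗ
        tensorAction ρ ((Algebra.ofId k (Module.End k k)).comp ε) x =
      ρ (Algebra.TensorProduct.rid k k H (Algebra.TensorProduct.map (AlgHom.id k H) ε x)) ∘ₗ
        (TensorProduct.rid k V).toLinearMap := by
  induction x with
  | zero => simp
  | add x y hx hy => simp only [map_add, LinearMap.comp_add, LinearMap.add_comp, hx, hy]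
  | tmul a b =>
    ext v
    simp [Algebra.ofId_apply]

theorem assoc_assoc_tmul_one (x : H ⊗[k] (H ⊗[k] H)) :
    Algebra.TensorProduct.map (AlgHom.id k H)
        ((Algebra.TensorProduct.assoc k k k H H H :
          (H ⊗[k] H) ⊗[k] H ≃ₐ[k] H ⊗[k] (H ⊗[k] H)) :
          (H ⊗[k] H) ⊗[k] H →ₐ[k] H ⊗[k] (H ⊗[k] H))
        (Algebra.TensorProduct.assoc k k k H (H ⊗[k] H) H (x ⊗ₜ[k] (1 : H))) =
      Algebra.TensorProduct.map (AlgHom.id k H)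
        (Algebra.TensorProduct.map (AlgHom.id k H)
          (Algebra.TensorProduct.includeLeft : H →ₐ[k] H ⊗[k] H)) x := by
  induction x with
  | zero => simp
  | add x y hx hy => simp only [TensorProduct.add_tmul, map_add, hx, hy]
  | tmul a x =>
    induction x with
    | zero => simp
    | add x y hx hy =>
      simp only [TensorProduct.add_tmul, TensorProduct.tmul_add, map_add, hx, hy]
    | tmul b c => simp

variable [QuasiBialgebra k H]

/-- The linear isomorphism `(V ⊗ W) ⊗ U → V ⊗ (W ⊗ U)`, `(v ⊗ w) ⊗ u ↦ Φ · (v ⊗ (w ⊗ u))`. -/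
noncomputable def assocEquiv (ρ : H →ₐ[k] Module.End k V) (σ : H →ₐ[k] Module.End k W)
    (τ : H →ₐ[k] Module.End k U) : (V ⊗[k] W) ⊗[k] U ≃ₗ[k] V ⊗[k] (W ⊗[k] U) :=
  TensorProduct.assoc k V W U ≪≫ₗ
    LinearEquiv.ofLinearMap
      (tensorAction ρ (tensorAction σ τ) (assoc (k := k) (H := H) : H ⊗[k] (H ⊗[k] H)))
      (tensorAction ρ (tensorAction σ τ) (↑(assoc (k := k) (H := H))⁻¹ : H ⊗[k] (H ⊗[k] H)))
      (by rw [← Module.End.mul_eq_comp, ← map_mul, Units.mul_inv, map_one]; rfl)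
      (by rw [← Module.End.mul_eq_comp, ← map_mul, Units.inv_mul, map_one]; rfl)

theorem assocEquiv_toLinearMap (ρ : H →ₐ[k] Module.End k V) (σ : H →ₐ[k] Module.End k W)
    (τ : H →ₐ[k] Module.End k U) : (assocEquiv ρ σ τ).toLinearMap =
      tensorAction ρ (tensorAction σ τ) (assoc (k := k) (H := H) : H ⊗[k] (H ⊗[k] H)) ∘ₗ
        (TensorProduct.assoc k V W U).toLinearMap := rfl

theorem assocEquiv_comm (ρ : H →ₐ[k] Module.End k V) (σ : H →ₐ[k] Module.End k W)
    (τ : H →ₐ[k] Module.End k U) (h : H) :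
    (assocEquiv ρ σ τ).toLinearMap ∘ₗ
        tensorAction ((tensorAction ρ σ).comp comul) τ (comul (k := k) h) =
      tensorAction ρ ((tensorAction σ τ).comp comul) (comul (k := k) h) ∘ₗ
        (assocEquiv ρ σ τ).toLinearMap := by
  have h₁ := tensorAction_map (tensorAction ρ σ) τ (comul (k := k) (H := H)) (AlgHom.id k H)
    (comul h)
  have h₂ := tensorAction_map ρ (tensorAction σ τ) (AlgHom.id k H) (comul (k := k) (H := H))
    (comul h)
  rw [AlgHom.comp_id] at h₁ h₂
  rw [← h₁, ← h₂, assocEquiv_toLinearMap, LinearMap.comp_assoc, tensorAction_assoc,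
    ← LinearMap.comp_assoc, ← LinearMap.comp_assoc, ← Module.End.mul_eq_comp,
    ← Module.End.mul_eq_comp, ← map_mul, ← map_mul, quasi_coassoc]

theorem assocEquiv_natural {V' W' U' : Type*} [AddCommGroup V'] [Module k V'] [AddCommGroup W']
    [Module k W'] [AddCommGroup U'] [Module k U']
    {ρ : H →ₐ[k] Module.End k V} {σ : H →ₐ[k] Module.End k W} {τ : H →ₐ[k] Module.End k U}
    {ρ' : H →ₐ[k] Module.End k V'} {σ' : H →ₐ[k] Module.End k W'} {τ' : H →ₐ[k] Module.End k U'}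
    (f : V →ₗ[k] V') (g : W →ₗ[k] W') (e : U →ₗ[k] U') (hf : ∀ a, f ∘ₗ ρ a = ρ' a ∘ₗ f)
    (hg : ∀ a, g ∘ₗ σ a = σ' a ∘ₗ g) (he : ∀ a, e ∘ₗ τ a = τ' a ∘ₗ e) :
    (assocEquiv ρ' σ' τ').toLinearMap ∘ₗ TensorProduct.map (TensorProduct.map f g) e =
      TensorProduct.map f (TensorProduct.map g e) ∘ₗ (assocEquiv ρ σ τ).toLinearMap := by
  rw [assocEquiv_toLinearMap, assocEquiv_toLinearMap, ← LinearMap.comp_assoc,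
    map_comp_tensorAction f _ hf (map_comp_tensorAction g e hg he), LinearMap.comp_assoc,
    LinearMap.comp_assoc, TensorProduct.map_map_comp_assoc_eq]

theorem triangle_aux (ρ : H →ₐ[k] Module.End k V) (σ : H →ₐ[k] Module.End k W) :
    TensorProduct.map LinearMap.id (TensorProduct.lid k W).toLinearMap ∘ₗ
        (assocEquiv ρ ((Algebra.ofId k (Module.End k k)).comp counit) σ).toLinearMap =
      TensorProduct.map (TensorProduct.rid k V).toLinearMap LinearMap.id := by
  have key := map_comp_tensorAction (ρ := ρ) (ρ' := ρ)
      (σ := tensorAction ((Algebra.ofId k (Module.End k k)).comp counit) σ)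
      (σ' := σ.comp (((Algebra.TensorProduct.lid k H : k ⊗[k] H ≃ₐ[k] H) :
        k ⊗[k] H →ₐ[k] H).comp
        (Algebra.TensorProduct.map (counit (k := k) (H := H)) (AlgHom.id k H))))
      LinearMap.id (TensorProduct.lid k W).toLinearMap (fun _ => rfl)
      (fun b => lid_comp_tensorAction counit σ b)
      (assoc (k := k) (H := H) : H ⊗[k] (H ⊗[k] H))
  have h₂ := tensorAction_map ρ σ (AlgHom.id k H)
      (((Algebra.TensorProduct.lid k H : k ⊗[k] H ≃ₐ[k] H) : k ⊗[k] H →ₐ[k] H).comp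
        (Algebra.TensorProduct.map (counit (k := k) (H := H)) (AlgHom.id k H)))
      (assoc (k := k) (H := H) : H ⊗[k] (H ⊗[k] H))
  rw [counit_assoc, map_one, AlgHom.comp_id] at h₂
  rw [← h₂, Module.End.one_eq_id, LinearMap.id_comp] at key
  rw [assocEquiv_toLinearMap, ← LinearMap.comp_assoc, key]
  apply TensorProduct.ext_threefold
  intro x c y
  exact (TensorProduct.smul_tmul c x y).symm

theorem pentagon_aux (ρ : H →ₐ[k] Module.End k V) (σ : H →ₐ[k] Module.End k W)
    (τ : H →ₐ[k] Module.End k U) (χ : H →ₐ[k] Module.End k X) :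
    TensorProduct.map LinearMap.id (assocEquiv σ τ χ).toLinearMap ∘ₗ
      (assocEquiv ρ ((tensorAction σ τ).comp comul) χ).toLinearMap ∘ₗ
      TensorProduct.map (assocEquiv ρ σ τ).toLinearMap LinearMap.id =
    (assocEquiv ρ σ ((tensorAction τ χ).comp comul)).toLinearMap ∘ₗ
      (assocEquiv ((tensorAction ρ σ).comp comul) τ χ).toLinearMap := by
  set Φ : H ⊗[k] (H ⊗[k] H) := (assoc (k := k) (H := H) : H ⊗[k] (H ⊗[k] H)) with hΦ
  set Δ : H →ₐ[k] H ⊗[k] H := comul with hΔ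
  set P := tensorAction ρ (tensorAction σ (tensorAction τ χ)) with hP
  have e₁ : TensorProduct.map (LinearMap.id : V →ₗ[k] V) (assocEquiv σ τ χ).toLinearMap =
      P ((1 : H) ⊗ₜ[k] Φ) ∘ₗ
        TensorProduct.map LinearMap.id (TensorProduct.assoc k W U X).toLinearMap := by
    rw [hP, tensorAction_tmul, ← TensorProduct.map_comp, map_one]
    rfl
  have e₂ : TensorProduct.map (LinearMap.id : V →ₗ[k] V)
        (TensorProduct.assoc k W U X).toLinearMap ∘ₗ
        tensorAction ρ (tensorAction ((tensorAction σ τ).comp Δ) χ) Φ =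
      P (Algebra.TensorProduct.map (AlgHom.id k H)
        ((Algebra.TensorProduct.assoc k k k H H H :
          (H ⊗[k] H) ⊗[k] H →ₐ[k] H ⊗[k] (H ⊗[k] H)).comp
          (Algebra.TensorProduct.map Δ (AlgHom.id k H))) Φ) ∘ₗ
        TensorProduct.map LinearMap.id (TensorProduct.assoc k W U X).toLinearMap := by
    rw [hP, tensorAction_map]
    apply map_comp_tensorAction
    · intro a; rfl
    · intro b
      have := tensorAction_map (tensorAction σ τ) χ Δ (AlgHom.id k H) b
      rw [AlgHom.comp_id] at this
      rw [← this, tensorAction_assoc]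
      rfl
  have e₃ : TensorProduct.map (LinearMap.id : V →ₗ[k] V)
        (TensorProduct.assoc k W U X).toLinearMap ∘ₗ
        (TensorProduct.assoc k V (W ⊗[k] U) X).toLinearMap ∘ₗ
        TensorProduct.map (tensorAction ρ (tensorAction σ τ) Φ) (LinearMap.id : X →ₗ[k] X) =
      P (Algebra.TensorProduct.map (AlgHom.id k H)
        (Algebra.TensorProduct.map (AlgHom.id k H)
          (Algebra.TensorProduct.includeLeft : H →ₐ[k] H ⊗[k] H)) Φ) ∘ₗ
        TensorProduct.map LinearMap.id (TensorProduct.assoc k W U X).toLinearMap ∘ₗ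
        (TensorProduct.assoc k V (W ⊗[k] U) X).toLinearMap := by
    have h₁ : TensorProduct.map (tensorAction ρ (tensorAction σ τ) Φ) (LinearMap.id : X →ₗ[k] X) =
        tensorAction (tensorAction ρ (tensorAction σ τ)) χ (Φ ⊗ₜ[k] (1 : H)) := by
      rw [tensorAction_tmul, map_one]; rfl
    rw [h₁, tensorAction_assoc, ← assoc_assoc_tmul_one, hP, tensorAction_map,
      ← LinearMap.comp_assoc, ← LinearMap.comp_assoc]
    congr 1
    apply map_comp_tensorAction
    · intro a; rfl
    · intro b
      exact tensorAction_assoc σ τ χ b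
  have e₄ : tensorAction ρ (tensorAction σ ((tensorAction τ χ).comp Δ)) Φ =
      P (Algebra.TensorProduct.map (AlgHom.id k H)
        (Algebra.TensorProduct.map (AlgHom.id k H) Δ) Φ) := by
    rw [hP, tensorAction_map, AlgHom.comp_id]
    congr 2
    refine AlgHom.ext fun b => ?_
    rw [AlgHom.comp_apply, tensorAction_map, AlgHom.comp_id]
  have e₅ : (TensorProduct.assoc k V W (U ⊗[k] X)).toLinearMap ∘ₗ
        tensorAction ((tensorAction ρ σ).comp Δ) (tensorAction τ χ) Φ =
      P (Algebra.TensorProduct.assoc k k k H H (H ⊗[k] H)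
        (Algebra.TensorProduct.map Δ (AlgHom.id k (H ⊗[k] H)) Φ)) ∘ₗ
        (TensorProduct.assoc k V W (U ⊗[k] X)).toLinearMap := by
    have := tensorAction_map (tensorAction ρ σ) (tensorAction τ χ) Δ
      (AlgHom.id k (H ⊗[k] H)) Φ
    rw [AlgHom.comp_id] at this
    rw [← this, tensorAction_assoc]
  have e₆ : TensorProduct.map (LinearMap.id : V →ₗ[k] V)
        (TensorProduct.assoc k W U X).toLinearMap ∘ₗ
        (TensorProduct.assoc k V (W ⊗[k] U) X).toLinearMap ∘ₗ
        TensorProduct.map (TensorProduct.assoc k V W U).toLinearMap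
          (LinearMap.id : X →ₗ[k] X) =
      (TensorProduct.assoc k V W (U ⊗[k] X)).toLinearMap ∘ₗ
        (TensorProduct.assoc k (V ⊗[k] W) U X).toLinearMap := by
    apply TensorProduct.ext_fourfold
    intro a b c d
    rfl
  have e₇ : TensorProduct.map (assocEquiv ρ σ τ).toLinearMap (LinearMap.id : X →ₗ[k] X) =
      TensorProduct.map (tensorAction ρ (tensorAction σ τ) Φ) LinearMap.id ∘ₗ
        TensorProduct.map (TensorProduct.assoc k V W U).toLinearMap LinearMap.id := by
    rw [← TensorProduct.map_comp]; rfl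
  have pent := congrArg P (pentagon (k := k) (H := H))
  rw [map_mul, map_mul, map_mul, Module.End.mul_eq_comp, Module.End.mul_eq_comp,
    Module.End.mul_eq_comp] at pent
  calc _ = (P ((1 : H) ⊗ₜ[k] Φ) ∘ₗ
          (TensorProduct.map LinearMap.id (TensorProduct.assoc k W U X).toLinearMap ∘ₗ
            tensorAction ρ (tensorAction ((tensorAction σ τ).comp Δ) χ) Φ)) ∘ₗ
        (TensorProduct.assoc k V (W ⊗[k] U) X).toLinearMap ∘ₗ
        TensorProduct.map (tensorAction ρ (tensorAction σ τ) Φ) LinearMap.id ∘ₗ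
        TensorProduct.map (TensorProduct.assoc k V W U).toLinearMap LinearMap.id := by
          rw [e₁, e₇, assocEquiv_toLinearMap]
          simp only [LinearMap.comp_assoc]
          rfl
    _ = (P ((1 : H) ⊗ₜ[k] Φ) ∘ₗ
          P (Algebra.TensorProduct.map (AlgHom.id k H)
        ((Algebra.TensorProduct.assoc k k k H H H :
          (H ⊗[k] H) ⊗[k] H →ₐ[k] H ⊗[k] (H ⊗[k] H)).comp
          (Algebra.TensorProduct.map Δ (AlgHom.id k H))) Φ)) ∘ₗ
        (TensorProduct.map LinearMap.id (TensorProduct.assoc k W U X).toLinearMap ∘ₗ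
        (TensorProduct.assoc k V (W ⊗[k] U) X).toLinearMap ∘ₗ
        TensorProduct.map (tensorAction ρ (tensorAction σ τ) Φ) LinearMap.id) ∘ₗ
        TensorProduct.map (TensorProduct.assoc k V W U).toLinearMap LinearMap.id := by
          rw [e₂]
          simp only [LinearMap.comp_assoc]
    _ = _ := by
          rw [e₃]
          simp only [LinearMap.comp_assoc] at pent ⊢
          rw [e₆, assocEquiv_toLinearMap, assocEquiv_toLinearMap, e₄]
          have pent' := congrArg (fun f => f ∘ₗ (TensorProduct.assoc k V W (U ⊗[k] X)).toLinearMap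
            ∘ₗ (TensorProduct.assoc k (V ⊗[k] W) U X).toLinearMap) pent
          simp only [LinearMap.comp_assoc] at pent'
          have e₅' := congrArg
            (fun f => f ∘ₗ (TensorProduct.assoc k (V ⊗[k] W) U X).toLinearMap) e₅
          simp only [LinearMap.comp_assoc] at e₅'
          rw [← pent']
          exact congrArg (fun f => P (Algebra.TensorProduct.map (AlgHom.id k H)
            (Algebra.TensorProduct.map (AlgHom.id k H) Δ) Φ) ∘ₗ f) e₅'.symm

end Coherence

section Monoidal

open QuasiBialgebra MonoidalCategory

variable {k : Type u} {H : Type v} [Field k] [Ring H] [Algebra k H] [QuasiBialgebra k H]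

/-- The tensor product of representations: `h` acts on `V ⊗ W` by `Δ(h)`. -/
@[reducible]
noncomputable def tensor (X Y : FDRepr k H) : FDRepr k H where
  V := X.V ⊗[k] Y.V
  ρ := (tensorAction X.ρ Y.ρ).comp comul

/-- The unit representation: `k`, on which `h` acts by `ε(h)`. -/
@[reducible]
def unit : FDRepr k H where
  V := k
  ρ := (Algebra.ofId k (Module.End k k)).comp counit

/-- The tensor product of morphisms. -/
noncomputable def tensorMap {X₁ Y₁ X₂ Y₂ : FDRepr k H} (f : X₁ ⟶ Y₁) (g : X₂ ⟶ Y₂) :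
    tensor X₁ X₂ ⟶ tensor Y₁ Y₂ :=
  ⟨TensorProduct.map f.lin g.lin, fun h =>
    map_comp_tensorAction f.lin g.lin f.comm g.comm (comul h)⟩

noncomputable instance : MonoidalCategoryStruct (FDRepr k H) where
  tensorObj := tensor
  whiskerLeft X _ _ g := tensorMap (𝟙 X) g
  whiskerRight f Y := tensorMap f (𝟙 Y)
  tensorHom f g := tensorMap f g
  tensorUnit := unit
  associator X Y Z := mkIso (X := tensor (tensor X Y) Z) (Y := tensor X (tensor Y Z))
    (assocEquiv X.ρ Y.ρ Z.ρ) (assocEquiv_comm X.ρ Y.ρ Z.ρ)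
  leftUnitor X := mkIso (X := tensor unit X) (TensorProduct.lid k X.V) fun h =>
    (lid_comp_tensorAction counit X.ρ (comul h)).trans (by rw [counit_left])
  rightUnitor X := mkIso (X := tensor X unit) (TensorProduct.rid k X.V) fun h =>
    (rid_comp_tensorAction counit X.ρ (comul h)).trans (by rw [counit_right])

/-- The monoidal category `Rep(H)`, with associativity constraint given by the action of `Φ` and
the unit constraints of vector spaces. -/
noncomputable instance : MonoidalCategory (FDRepr k H) where
  tensorHom_def f g := by
    apply hom_ext
    refine Eq.trans ?_ (TensorProduct.map_comp _ _ _ _)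
    simp only [id_lin, LinearMap.id_comp, LinearMap.comp_id]
    rfl
  id_tensorHom_id X Y := hom_ext TensorProduct.map_id
  tensorHom_comp_tensorHom f₁ f₂ g₁ g₂ := hom_ext (TensorProduct.map_comp _ _ _ _).symm
  whiskerLeft_id X Y := hom_ext TensorProduct.map_id
  id_whiskerRight X Y := hom_ext TensorProduct.map_id
  associator_naturality f₁ f₂ f₃ :=
    hom_ext (assocEquiv_natural f₁.lin f₂.lin f₃.lin f₁.comm f₂.comm f₃.comm)
  leftUnitor_naturality f := hom_ext <| TensorProduct.ext' fun c x => (f.lin.map_smul c x).symm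
  rightUnitor_naturality f := hom_ext <| TensorProduct.ext' fun x c => (f.lin.map_smul c x).symm
  pentagon W X Y Z := hom_ext (pentagon_aux W.ρ X.ρ Y.ρ Z.ρ)
  triangle X Y := hom_ext (triangle_aux X.ρ Y.ρ)

end Monoidal

end FDRepr

/-- `Rep(H₁)` and `Rep(H₂)` are equivalent as tensor categories: there is a `k`-linear (strong)
monoidal functor `Rep(H₁) → Rep(H₂)` which is an equivalence of categories. -/
def TensorEquivalentRep (k : Type u) [Field k] (H₁ H₂ : Type*)
    [Ring H₁] [Algebra k H₁] [QuasiBialgebra k H₁]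
    [Ring H₂] [Algebra k H₂] [QuasiBialgebra k H₂] : Prop :=
  ∃ F : FDRepr k H₁ ⥤ FDRepr k H₂, F.IsEquivalence ∧ F.Additive ∧ F.Linear k ∧
    Nonempty F.Monoidal

-- A twist equivalence yields a tensor equivalence by restricting actions along the algebra
-- isomorphism `φ : H₂ → H₁` and letting `J` act as the tensorator: the formula for `Δ^J` says that
-- `J` is equivariant, the formula for `Φ^J` is the associativity diagram, and the normalisation of
-- `J` is unitality (`restrictCoreMonoidal`).
--
-- The converse is Tannakian reconstruction; the difficulty is that the equivalence `F` is not
-- assumed to respect the forgetful functors. Counting morphisms out of a regular representation, or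
-- out of a preimage of one, into tensor powers bounds `(dim F X)^n` and `(dim X)^n` by constant
-- multiples of each other, so `F` preserves dimensions (`finrank_obj_of_tensorEquivalence`). Hence
-- a preimage `P` of the regular representation of `H₂` satisfies `dim Hom(P, Z) = dim Z = dim
-- Hom(H₁, Z)` for every `Z`. These dimensions determine a finite-dimensional module up to
-- isomorphism (`Module.nonempty_linearEquiv_of_finrank_hom_eq`), so `F` sends the regular
-- representation of `H₁` to that of `H₂`.
--
-- Regular representations represent the forgetful functors, whence a natural isomorphism `η` from
-- the forgetful functor to its composite with `F`. By Yoneda, natural endomorphisms of the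
-- forgetful functor and of its tensor square are elements of `H₁` and `H₁ ⊗ H₁`. Transported
-- through `η`, the action of `H₂` becomes an algebra map `φ` and the tensorator becomes a unit `J`.
-- The monoidal functor axioms, tested on the faithful regular representation, are then the required
-- identities for `φ` and `J`.

universe w

/-! ### Modules determined by the dimensions of Hom spaces -/

section HomDimension

open Module

variable (k : Type u) {A : Type v} [Field k] [Ring A] [Algebra k A]

section Basic

variable {M N X : Type*} [AddCommGroup M] [Module k M] [Module A M] [IsScalarTower k A M]
  [AddCommGroup N] [Module k N] [Module A N] [IsScalarTower k A N]
  [AddCommGroup X] [Module k X] [Module A X] [IsScalarTower k A X]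

theorem LinearMap.finite_hom_of_finite_of_isScalarTower [Module.Finite k M] [Module.Finite k X] :
    Module.Finite k (M →ₗ[A] X) :=
  Module.Finite.of_injective (LinearMap.restrictScalarsₗ k A M X k)
    (LinearMap.restrictScalars_injective k)

/-- Postcomposition with an `A`-linear map, as a `k`-linear map between spaces of `A`-linear
maps. -/
def LinearMap.postcomp (M : Type*) [AddCommGroup M] [Module k M] [Module A M] [IsScalarTower k A M]
    (g : N →ₗ[A] X) : (M →ₗ[A] N) →ₗ[k] (M →ₗ[A] X) where
  toFun f := g ∘ₗ f
  map_add' f f' := LinearMap.comp_add _ _ _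
  map_smul' c f := by
    ext m
    exact (g.restrictScalars k).map_smul c (f m)

/-- The kernel of postcomposition with `g` consists of the maps into the kernel of `g`. -/
def LinearMap.kerPostcompEquiv (M : Type*) [AddCommGroup M] [Module k M] [Module A M]
    [IsScalarTower k A M] (g : N →ₗ[A] X) :
    (M →ₗ[A] LinearMap.ker g) ≃ₗ[k] LinearMap.ker (LinearMap.postcomp k M g) where
  toFun f := ⟨(LinearMap.ker g).subtype ∘ₗ f, by
    rw [LinearMap.mem_ker]
    ext m
    exact (f m).2⟩
  map_add' f f' := by
    ext m
    rfl
  map_smul' c f := by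
    ext m
    rfl
  invFun f := LinearMap.codRestrict (LinearMap.ker g) f.1 fun m =>
    LinearMap.congr_fun (LinearMap.mem_ker.1 f.2) m
  left_inv f := by
    ext m
    rfl
  right_inv f := by
    ext m
    rfl

/-- A retraction `r` of `M` onto `Z` splits `M` as the product of `Z` and the kernel of `r`. -/
def LinearEquiv.prodKerOfRetraction (s : N →ₗ[A] M) (r : M →ₗ[A] N)
    (h : r ∘ₗ s = LinearMap.id) : M ≃ₗ[A] N × LinearMap.ker r where
  toFun m := (r m, ⟨m - s (r m), by
    have : r (s (r m)) = r m := LinearMap.congr_fun h (r m)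
    simp [this]⟩)
  map_add' m m' := by
    ext
    · simp
    · simp only [map_add, Prod.snd_add, Submodule.coe_add]
      abel
  map_smul' c m := by
    ext
    · simp
    · simp [smul_sub]
  invFun p := s p.1 + p.2
  left_inv m := by simp
  right_inv p := by
    have h1 : r (s p.1) = p.1 := LinearMap.congr_fun h p.1
    ext <;> simp [h1]

omit [Module k M] [IsScalarTower k A M] [Module k N] [IsScalarTower k A N] in
theorem LinearMap.finrank_hom_congr (e : M ≃ₗ[A] N) :
    finrank k (M →ₗ[A] X) = finrank k (N →ₗ[A] X) :=
  LinearEquiv.finrank_eq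
    { toFun f := f ∘ₗ e.symm.toLinearMap
      map_add' _ _ := rfl
      map_smul' _ _ := rfl
      invFun f := f ∘ₗ e.toLinearMap
      left_inv f := by ext; simp
      right_inv f := by ext; simp }

/-- The retraction splits `M` as `N × ker r`, and maps out of a product of two modules are pairs of
maps. This is what allows a common summand to be cancelled later. -/
theorem LinearMap.finrank_hom_of_retraction [Module.Finite k M] [Module.Finite k N]
    [Module.Finite k X] (s : N →ₗ[A] M) (r : M →ₗ[A] N) (h : r ∘ₗ s = LinearMap.id) :
    finrank k (M →ₗ[A] X) = finrank k (N →ₗ[A] X) + finrank k (LinearMap.ker r →ₗ[A] X) := by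
  have : Module.Finite k (LinearMap.ker r) :=
    inferInstanceAs (Module.Finite k (LinearMap.ker (r.restrictScalars k)))
  have := LinearMap.finite_hom_of_finite_of_isScalarTower k (A := A) (M := N) (X := X)
  have := LinearMap.finite_hom_of_finite_of_isScalarTower k (A := A) (M := LinearMap.ker r) (X := X)
  rw [LinearMap.finrank_hom_congr k (LinearEquiv.prodKerOfRetraction s r h),
    ← (LinearMap.coprodEquiv (R := A) (M := N) (M₂ := LinearMap.ker r) (M₃ := X) k).finrank_eq,
    finrank_prod]

/-- If all `k`-spaces of maps out of `M` and `N` have equal dimensions, then `N` is a retract of a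
power of `M`. -/
theorem LinearMap.exists_sum_comp_eq_id {M N : Type w}
    [AddCommGroup M] [Module k M] [Module A M] [IsScalarTower k A M] [Module.Finite k M]
    [AddCommGroup N] [Module k N] [Module A N] [IsScalarTower k A N] [Module.Finite k N]
    (h : ∀ (X : Type w) [AddCommGroup X] [Module k X] [Module A X] [IsScalarTower k A X]
      [Module.Finite k X], finrank k (M →ₗ[A] X) = finrank k (N →ₗ[A] X)) :
    ∃ (r : ℕ) (a : Fin r → N →ₗ[A] M) (b : Fin r → M →ₗ[A] N),
      ∑ i, b i ∘ₗ a i = LinearMap.id := by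
  have := LinearMap.finite_hom_of_finite_of_isScalarTower k (A := A) (M := M) (X := N)
  let b := finBasis k (M →ₗ[A] N)
  let g : (Fin (finrank k (M →ₗ[A] N)) → M) →ₗ[A] N := ∑ i, b i ∘ₗ LinearMap.proj i
  have : Module.Finite k (LinearMap.ker g) :=
    inferInstanceAs (Module.Finite k (LinearMap.ker (g.restrictScalars k)))
  -- Every map `M → N` is a combination of the basis maps `b i`, so it lifts through `g` by using
  -- its coordinates as scalars.
  have surjM : LinearMap.range (LinearMap.postcomp k M g) = ⊤ := by
    rw [LinearMap.range_eq_top]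
    intro f
    refine ⟨LinearMap.pi fun i => b.repr f i • LinearMap.id, ?_⟩
    conv_rhs => rw [← b.sum_repr f]
    ext m
    simp only [postcomp, coe_mk, AddHom.coe_mk, coe_comp, Function.comp_apply, g,
      LinearMap.sum_apply, proj_apply, pi_apply, smul_apply, id_apply]
    exact Finset.sum_congr rfl fun i _ => ((b i).restrictScalars k).map_smul _ m
  have finM := LinearMap.finite_hom_of_finite_of_isScalarTower k (A := A) (M := M)
    (X := Fin (finrank k (M →ₗ[A] N)) → M)
  have finN := LinearMap.finite_hom_of_finite_of_isScalarTower k (A := A) (M := N)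
    (X := Fin (finrank k (M →ₗ[A] N)) → M)
  have finNN := LinearMap.finite_hom_of_finite_of_isScalarTower k (A := A) (M := N) (X := N)
  have rankM := LinearMap.finrank_range_add_finrank_ker (LinearMap.postcomp k M g)
  have rankN := LinearMap.finrank_range_add_finrank_ker (LinearMap.postcomp k N g)
  rw [surjM, finrank_top, ← (LinearMap.kerPostcompEquiv k M g).finrank_eq] at rankM
  rw [← (LinearMap.kerPostcompEquiv k N g).finrank_eq] at rankN
  have hN := h N
  have hK := h (LinearMap.ker g)
  have hP := h (Fin (finrank k (M →ₗ[A] N)) → M)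
  -- The rank of `Hom(-, g)` is determined by Hom dimensions into `ker g`, the power of `M` and `N`.
  -- These agree for `M` and `N`, so surjectivity passes from `M` to `N`, and the identity of `N`
  -- lifts through `g`.
  have surjN : LinearMap.range (LinearMap.postcomp k N g) = ⊤ :=
    Submodule.eq_top_of_finrank_eq (by omega)
  obtain ⟨f, hf⟩ := LinearMap.range_eq_top.1 surjN LinearMap.id
  refine ⟨_, fun i => LinearMap.proj i ∘ₗ f, b, ?_⟩
  rw [← hf]
  ext m
  simp [postcomp, g]

end Basic

section Indecomposable

variable {Z : Type*} [AddCommGroup Z] [Module A Z]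

/-- Fitting's lemma: the endomorphism ring of an indecomposable module of finite length is
local. -/
theorem Module.End.isLocalRing_of_indecomposable [Nontrivial Z] [IsArtinian A Z]
    [IsNoetherian A Z] (h : ∀ p q : Submodule A Z, IsCompl p q → p = ⊥ ∨ q = ⊥) :
    IsLocalRing (Module.End A Z) := by
  refine IsLocalRing.of_isUnit_or_isUnit_one_sub_self fun f => ?_
  obtain ⟨n, hn⟩ := Filter.eventually_atTop.1 f.eventually_isCompl_ker_pow_range_pow
  -- The exponent must be nonzero for invertibility of the power to imply that of `f`.
  have hn := hn (n + 1) (by omega)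
  rcases h _ _ hn with hk | hr
  · left
    have hr : LinearMap.range (f ^ (n + 1)) = ⊤ := by
      have := hn.sup_eq_top
      rwa [hk, bot_sup_eq] at this
    have : IsUnit (f ^ (n + 1)) := by
      rw [Module.End.isUnit_iff]
      exact ⟨LinearMap.ker_eq_bot.1 hk, LinearMap.range_eq_top.1 hr⟩
    exact (isUnit_pow_iff (by omega)).1 this
  · right
    exact IsNilpotent.isUnit_one_sub ⟨n + 1, LinearMap.range_eq_bot.1 hr⟩

/-- Every nonzero finite-dimensional module has a nonzero retract with local endomorphism ring. -/
theorem Module.exists_retract_isLocalRing_end (N : Type w)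
    [AddCommGroup N] [Module k N] [Module A N] [IsScalarTower k A N] [Module.Finite k N]
    [Nontrivial N] :
    ∃ (Z : Submodule A N) (s : Z →ₗ[A] N) (r : N →ₗ[A] Z), Nontrivial Z ∧
      r ∘ₗ s = LinearMap.id ∧ IsLocalRing (Module.End A Z) := by
  classical
  have fin (Z : Submodule A N) : Module.Finite k Z :=
    inferInstanceAs (Module.Finite k (Z.restrictScalars k))
  let P : ℕ → Prop := fun n => ∃ (Z : Submodule A N) (s : Z →ₗ[A] N) (r : N →ₗ[A] Z),
    Nontrivial Z ∧ r ∘ₗ s = LinearMap.id ∧ finrank k Z = n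
  have hP : ∃ n, P n := ⟨_, ⊤, Submodule.subtype _, LinearMap.codRestrict _ LinearMap.id
    (fun _ => trivial), (Submodule.topEquiv (R := A) (M := N)).toEquiv.nontrivial, rfl, rfl⟩
  -- A nonzero retract of least dimension is indecomposable: a nonzero summand `p` of it is again a
  -- retract of `N`, so it has the same dimension and its complement vanishes.
  obtain ⟨Z, s, r, hZ, hrs, hd⟩ := Nat.find_spec hP
  refine ⟨Z, s, r, hZ, hrs, ?_⟩
  have := fin Z
  have : IsArtinian A Z := isArtinian_of_tower k inferInstance
  have : IsNoetherian A Z := isNoetherian_of_tower k inferInstance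
  refine Module.End.isLocalRing_of_indecomposable fun p q hpq => ?_
  by_contra! hne
  have : Nontrivial p := Submodule.nontrivial_iff_ne_bot.2 hne.1
  have fp : Module.Finite k p := inferInstanceAs (Module.Finite k (p.restrictScalars k))
  -- The minimised predicate ranges over submodules of `N`, so `p`, a submodule of `Z`, is replaced
  -- by its image in `N`.
  let e : p ≃ₗ[A] p.map Z.subtype := Submodule.equivMapOfInjective _ Z.injective_subtype p
  have hmem : P (finrank k (p.map Z.subtype)) := by
    refine ⟨_, s ∘ₗ p.subtype ∘ₗ e.symm.toLinearMap,
      e.toLinearMap ∘ₗ p.projectionOnto q hpq ∘ₗ r, e.symm.toEquiv.nontrivial, ?_, rfl⟩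
    ext x
    have := LinearMap.congr_fun hrs (e.symm x)
    simp only [LinearMap.coe_comp, Function.comp_apply, LinearMap.id_apply] at this
    simp [this]
  have hle := Nat.find_min' hP hmem
  rw [← hd, ← (e.restrictScalars k).finrank_eq] at hle
  have hp : p.restrictScalars k = ⊤ := Submodule.eq_top_of_finrank_eq
    (le_antisymm (Submodule.finrank_le (p.restrictScalars k)) hle)
  have hp : p = ⊤ := by simpa using hp
  have := hpq.inf_eq_bot
  rw [hp, top_inf_eq] at this
  exact hne.2 this

end Indecomposable

/-- A finite-dimensional module `M` is determined up to isomorphism by the dimensions of the spaces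
of maps out of `M` (Auslander, Bongartz). -/
theorem Module.nonempty_linearEquiv_of_finrank_hom_eq {M N : Type w}
    [AddCommGroup M] [Module k M] [Module A M] [IsScalarTower k A M] [Module.Finite k M]
    [AddCommGroup N] [Module k N] [Module A N] [IsScalarTower k A N] [Module.Finite k N]
    (h : ∀ (X : Type w) [AddCommGroup X] [Module k X] [Module A X] [IsScalarTower k A X]
      [Module.Finite k X], finrank k (M →ₗ[A] X) = finrank k (N →ₗ[A] X)) :
    Nonempty (M ≃ₗ[A] N) := by
  induction hn : finrank k N using Nat.strong_induction_on generalizing M N with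
  | _ n ih =>
  obtain ⟨t, a, b, hab⟩ := LinearMap.exists_sum_comp_eq_id k h
  rcases subsingleton_or_nontrivial N with hN | hN
  -- With the roles exchanged, `M` is a retract of a power of `N = 0`.
  · obtain ⟨t, a, b, hab⟩ := LinearMap.exists_sum_comp_eq_id k fun X => (h X).symm
    have hM : Subsingleton M := by
      refine subsingleton_of_forall_eq 0 fun m => ?_
      have := LinearMap.congr_fun hab m
      rw [LinearMap.id_apply] at this
      rw [← this, LinearMap.sum_apply]
      exact Finset.sum_eq_zero fun i _ => by
        rw [LinearMap.comp_apply, Subsingleton.elim (a i m) 0, map_zero]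
    exact ⟨0⟩
  obtain ⟨Z, s, r, hZ, hrs, hloc⟩ := Module.exists_retract_isLocalRing_end k (A := A) N
  -- The identity of `Z` factors through a power of `M`. As `End Z` is local, one summand is already
  -- invertible, so `Z` is a retract of `M` itself.
  have hsum : IsUnit (∑ i, (r ∘ₗ b i ∘ₗ a i ∘ₗ s : Module.End A Z)) := by
    have : ∑ i, (r ∘ₗ b i ∘ₗ a i ∘ₗ s : Module.End A Z) = 1 := by
      ext z
      have h1 := LinearMap.congr_fun hab (s z)
      have h2 := LinearMap.congr_fun hrs z
      simp only [LinearMap.sum_apply, LinearMap.comp_apply, LinearMap.id_apply] at h1 h2 ⊢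
      rw [← map_sum, h1, h2, Module.End.one_apply]
    rw [this]
    exact isUnit_one
  obtain ⟨i, -, u, hu⟩ := IsLocalRing.exists_of_isUnit_sum hsum
  have hrs' : ((↑u⁻¹ : Module.End A Z) ∘ₗ r ∘ₗ b i) ∘ₗ (a i ∘ₗ s) = LinearMap.id := by
    have := u.inv_mul
    rw [hu] at this
    exact this
  have fin (M : Type w) [AddCommGroup M] [Module k M] [Module A M] [IsScalarTower k A M]
      [Module.Finite k M] (Z : Submodule A M) : Module.Finite k Z :=
    inferInstanceAs (Module.Finite k (Z.restrictScalars k))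
  have := fin N Z
  have := fin N (LinearMap.ker r)
  have := fin M (LinearMap.ker ((↑u⁻¹ : Module.End A Z) ∘ₗ r ∘ₗ b i))
  let eN := LinearEquiv.prodKerOfRetraction s r hrs
  let eM := LinearEquiv.prodKerOfRetraction _ _ hrs'
  have hlt : finrank k (LinearMap.ker r) < n := by
    rw [← hn, (eN.restrictScalars k).finrank_eq, finrank_prod]
    have : 0 < finrank k Z := finrank_pos
    omega
  -- Subtracting `dim Hom(Z, X)` from both sides shows that the complements of `Z` in `M` and in `N`
  -- satisfy the same hypothesis.
  obtain ⟨e⟩ := ih _ hlt (M := LinearMap.ker ((↑u⁻¹ : Module.End A Z) ∘ₗ r ∘ₗ b i)) (fun X => by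
    intros
    have h1 := LinearMap.finrank_hom_of_retraction k s r hrs (X := X)
    have h2 := LinearMap.finrank_hom_of_retraction k _ _ hrs' (X := X)
    have := h X
    omega) rfl
  exact ⟨eM.trans (((LinearEquiv.refl A Z).prodCongr e).trans eN.symm)⟩

end HomDimension

/-! ### Regular representations and preservation of dimension -/

namespace FDRepr

open Module

section Regular

variable {k : Type u} {H : Type v} [Field k] [Ring H] [Algebra k H]

/-- The underlying linear map of a morphism, as a linear function of the morphism. -/
@[simps]
def linₗ (X Y : FDRepr k H) : (X ⟶ Y) →ₗ[k] X.V →ₗ[k] Y.V where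
  toFun f := f.lin
  map_add' _ _ := rfl
  map_smul' _ _ := rfl

theorem linₗ_injective (X Y : FDRepr k H) : Function.Injective (linₗ X Y) :=
  fun _ _ h => hom_ext h

instance (X Y : FDRepr k H) : Module.Finite k (X ⟶ Y) :=
  Module.Finite.of_injective (linₗ X Y) (linₗ_injective X Y)

theorem finrank_hom_le (X Y : FDRepr k H) :
    finrank k (X ⟶ Y) ≤ finrank k X.V * finrank k Y.V := by
  rw [← finrank_linearMap k k]
  exact LinearMap.finrank_le_finrank_of_injective (linₗ_injective X Y)

theorem lin_comm_apply {X Y : FDRepr k H} (f : X ⟶ Y) (h : H) (x : X.V) :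
    f.lin (X.ρ h x) = Y.ρ h (f.lin x) :=
  LinearMap.congr_fun (f.comm h) x

/-- The underlying linear equivalence of an isomorphism of representations. -/
@[simps]
def linEquivOfIso {X Y : FDRepr k H} (e : X ≅ Y) : X.V ≃ₗ[k] Y.V where
  toFun := e.hom.lin
  map_add' := map_add _
  map_smul' := map_smul _
  invFun := e.inv.lin
  left_inv x := LinearMap.congr_fun (congrArg Hom.lin e.hom_inv_id) x
  right_inv x := LinearMap.congr_fun (congrArg Hom.lin e.inv_hom_id) x

/-- The `H`-module structure on a representation of `H`. -/
@[reducible]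
def moduleOfAction (X : FDRepr k H) : Module H X.V :=
  Module.compHom X.V X.ρ.toRingHom

theorem isScalarTower_moduleOfAction (X : FDRepr k H) :
    letI := X.moduleOfAction
    IsScalarTower k H X.V :=
  letI := X.moduleOfAction
  ⟨fun c h x => LinearMap.congr_fun (map_smul X.ρ c h) x⟩

/-- The representation given by a finite-dimensional module. -/
@[simps]
def ofModule (M : Type u) [AddCommGroup M] [Module k M] [Module H M] [IsScalarTower k H M]
    [FiniteDimensional k M] : FDRepr k H where
  V := M
  ρ := Algebra.lsmul k k M

/-- Morphisms from a representation to that of a module are the `H`-linear maps. -/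
def homOfModuleEquiv (X : FDRepr k H) (M : Type u) [AddCommGroup M] [Module k M] [Module H M]
    [IsScalarTower k H M] [FiniteDimensional k M] :
    letI := X.moduleOfAction
    (X ⟶ ofModule (k := k) (H := H) M) ≃ₗ[k] (X.V →ₗ[H] M) :=
  letI := X.moduleOfAction
  haveI := X.isScalarTower_moduleOfAction
  { toFun f :=
      { toFun := f.lin
        map_add' := map_add f.lin
        map_smul' h x := lin_comm_apply f h x }
    map_add' _ _ := rfl
    map_smul' _ _ := rfl
    invFun f := ⟨f.restrictScalars k, fun h => LinearMap.ext fun x => f.map_smul h x⟩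
    left_inv _ := rfl
    right_inv _ := rfl }

/-- A finite-dimensional representation is determined up to isomorphism by the dimensions of the
spaces of morphisms out of it. -/
theorem nonempty_iso_of_finrank_hom_eq {X Y : FDRepr k H}
    (h : ∀ Z : FDRepr k H, finrank k (X ⟶ Z) = finrank k (Y ⟶ Z)) : Nonempty (X ≅ Y) := by
  let := X.moduleOfAction
  let := Y.moduleOfAction
  have := X.isScalarTower_moduleOfAction
  have := Y.isScalarTower_moduleOfAction
  obtain ⟨e⟩ := Module.nonempty_linearEquiv_of_finrank_hom_eq k (A := H) (M := X.V) (N := Y.V)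
    fun M => by
      intros
      rw [← (homOfModuleEquiv X M).finrank_eq, ← (homOfModuleEquiv Y M).finrank_eq, h]
  exact ⟨mkIso (e.restrictScalars k) fun a => LinearMap.ext fun x => e.map_smul a x⟩

variable (k H) in
/-- The regular representation of `H`, transported to a space of coordinate vectors. -/
noncomputable def regular [FiniteDimensional k H] : FDRepr k H where
  -- Coordinates are used because `H` need not live in the universe of `k`, where representation
  -- spaces are required to lie.
  V := Fin (finrank k H) → k
  ρ := ((finBasis k H).equivFun.conjAlgEquiv k).toAlgHom.comp (Algebra.lmul k H)

variable (k H) in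
/-- The underlying space of the regular representation is `H`. -/
noncomputable def regularEquiv [FiniteDimensional k H] : H ≃ₗ[k] (regular k H).V :=
  (finBasis k H).equivFun

theorem regular_ρ [FiniteDimensional k H] (a b : H) :
    (regular k H).ρ a (regularEquiv k H b) = regularEquiv k H (a * b) :=
  congrArg (fun c => regularEquiv k H (a * c)) ((finBasis k H).equivFun.symm_apply_apply b)

/-- The morphism from the regular representation determined by a vector. -/
noncomputable def regularDesc [FiniteDimensional k H] (X : FDRepr k H) (x : X.V) :
    regular k H ⟶ X :=
  ⟨(X.ρ.toLinearMap.flip x) ∘ₗ (regularEquiv k H).symm.toLinearMap, fun h => by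
    ext y
    obtain ⟨b, rfl⟩ := (regularEquiv k H).surjective y
    simp [regular_ρ]⟩

theorem regularDesc_lin [FiniteDimensional k H] (X : FDRepr k H) (x : X.V) (h : H) :
    (regularDesc X x).lin (regularEquiv k H h) = X.ρ h x := by
  simp [regularDesc]

/-- Morphisms from the regular representation are vectors. -/
noncomputable def regularHomEquiv [FiniteDimensional k H] (X : FDRepr k H) :
    (regular k H ⟶ X) ≃ₗ[k] X.V where
  toFun f := f.lin (regularEquiv k H 1)
  map_add' _ _ := rfl
  map_smul' _ _ := rfl
  invFun := regularDesc X
  left_inv f := by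
    ext y
    obtain ⟨b, rfl⟩ := (regularEquiv k H).surjective y
    rw [regularDesc_lin, ← lin_comm_apply, regular_ρ, mul_one]
  right_inv x := by
    dsimp only
    rw [regularDesc_lin, map_one, Module.End.one_apply]

end Regular

section MapHom

variable {k : Type u} {H₁ : Type v} {H₂ : Type w} [Field k] [Ring H₁] [Algebra k H₁]
  [Ring H₂] [Algebra k H₂] (F : FDRepr k H₁ ⥤ FDRepr k H₂)

/-- A fully faithful linear functor is a linear isomorphism on morphisms. -/
noncomputable def mapHomEquiv [F.Additive] [F.Linear k] [F.Full] [F.Faithful]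
    (X Y : FDRepr k H₁) : (X ⟶ Y) ≃ₗ[k] (F.obj X ⟶ F.obj Y) :=
  LinearEquiv.ofBijective (F.mapLinearMap k) ⟨F.map_injective, F.map_surjective⟩

@[simp]
theorem mapHomEquiv_apply [F.Additive] [F.Linear k] [F.Full] [F.Faithful]
    {X Y : FDRepr k H₁} (f : X ⟶ Y) : mapHomEquiv F X Y f = F.map f := rfl

end MapHom

section TensorPower

open MonoidalCategory

variable {k : Type u} {H : Type v} [Field k] [Ring H] [Algebra k H] [QuasiBialgebra k H]

theorem finrank_tensorObj (X Y : FDRepr k H) :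
    finrank k (X ⊗ Y).V = finrank k X.V * finrank k Y.V :=
  finrank_tensorProduct (R := k) (M := X.V) (M' := Y.V)

/-- The tensor powers `X ⊗ (X ⊗ (⋯ ⊗ 𝟙))` of a representation. -/
noncomputable def tensorPower (X : FDRepr k H) : ℕ → FDRepr k H
  | 0 => 𝟙_ _
  | n + 1 => X ⊗ tensorPower X n

theorem finrank_tensorPower (X : FDRepr k H) (n : ℕ) :
    finrank k (X.tensorPower n).V = finrank k X.V ^ n := by
  induction n with
  | zero => exact (finrank_self k).trans (pow_zero _).symm
  | succ n ih => rw [tensorPower, finrank_tensorObj, ih, pow_succ']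

end TensorPower

/-- If `a > b > 0`, then `(a / b) ^ n` eventually exceeds the constant `c`. Passing to tensor powers
thus removes multiplicative constants from dimension estimates. -/
theorem le_of_forall_pow_le_mul_pow {a b c : ℕ} (h : ∀ n, a ^ n ≤ c * b ^ n) : a ≤ b := by
  by_contra! hab
  rcases Nat.eq_zero_or_pos b with rfl | hb
  · have := h 1
    simp at this
    omega
  · have hb' : (0 : ℝ) < b := by exact_mod_cast hb
    obtain ⟨n, hn⟩ := pow_unbounded_of_one_lt (c : ℝ)
      ((one_lt_div hb').2 (by exact_mod_cast hab : (b : ℝ) < a))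
    rw [div_pow, lt_div_iff₀ (pow_pos hb' n)] at hn
    exact absurd (h n) (not_le.2 (by exact_mod_cast hn))

section TensorEquivalence

open MonoidalCategory Functor

variable {k : Type u} {H₁ : Type v} {H₂ : Type w} [Field k]
  [Ring H₁] [Algebra k H₁] [QuasiBialgebra k H₁] [Ring H₂] [Algebra k H₂] [QuasiBialgebra k H₂]
  (F : FDRepr k H₁ ⥤ FDRepr k H₂)

theorem nonempty_map_tensorPower_iso [F.Monoidal] (X : FDRepr k H₁) (n : ℕ) :
    Nonempty (F.obj (X.tensorPower n) ≅ (F.obj X).tensorPower n) := by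
  induction n with
  | zero => exact ⟨(Monoidal.εIso F).symm⟩
  | succ n ih =>
    obtain ⟨e⟩ := ih
    exact ⟨(Monoidal.μIso F X (X.tensorPower n)).symm ≪≫ whiskerLeftIso (F.obj X) e⟩

variable [FiniteDimensional k H₁] [FiniteDimensional k H₂] [F.IsEquivalence] [F.Additive] [F.Linear k] [F.Monoidal]

/-- A tensor equivalence between categories of representations preserves dimensions. -/
theorem finrank_obj_of_tensorEquivalence (X : FDRepr k H₁) :
    finrank k (F.obj X).V = finrank k X.V := by
  apply le_antisymm
  -- Here `(dim F X)^n = dim Hom(H₂, (F X)^{⊗n}) = dim Hom(P, X^{⊗n}) ≤ dim P · (dim X)^n`.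
  · let P := F.objPreimage (regular k H₂)
    refine le_of_forall_pow_le_mul_pow (c := finrank k P.V) fun n => ?_
    obtain ⟨e⟩ := nonempty_map_tensorPower_iso F X n
    rw [← finrank_tensorPower, ← finrank_tensorPower, ← (regularHomEquiv _).finrank_eq,
      ← (Linear.homCongr k (F.objObjPreimageIso (regular k H₂)) e).finrank_eq,
      ← (mapHomEquiv F P (X.tensorPower n)).finrank_eq]
    exact finrank_hom_le _ _
  -- Here `(dim X)^n = dim Hom(H₁, X^{⊗n}) = dim Hom(F H₁, (F X)^{⊗n}) ≤ dim F H₁ · (dim F X)^n`.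
  · refine le_of_forall_pow_le_mul_pow (c := finrank k (F.obj (regular k H₁)).V) fun n => ?_
    obtain ⟨e⟩ := nonempty_map_tensorPower_iso F X n
    rw [← finrank_tensorPower, ← finrank_tensorPower, ← (regularHomEquiv _).finrank_eq,
      (mapHomEquiv F _ _).finrank_eq, ← (linEquivOfIso e).finrank_eq]
    exact finrank_hom_le _ _

/-- Maps into `Z` from the regular representation of `H₁` and from a preimage of that of `H₂` form
spaces of dimensions `dim Z` and `dim F Z`. These are equal, so the two sources are isomorphic. -/
theorem nonempty_regular_iso_obj_regular :
    Nonempty (regular k H₂ ≅ F.obj (regular k H₁)) := by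
  let i := F.objObjPreimageIso (regular k H₂)
  obtain ⟨e⟩ := nonempty_iso_of_finrank_hom_eq (X := F.objPreimage (regular k H₂))
    (Y := regular k H₁) fun Z => by
      rw [(regularHomEquiv Z).finrank_eq, ← finrank_obj_of_tensorEquivalence F Z,
        ← (regularHomEquiv (F.obj Z)).finrank_eq,
        ← (Linear.homCongr k i (Iso.refl (F.obj Z))).finrank_eq, (mapHomEquiv F _ _).finrank_eq]
  exact ⟨i.symm ≪≫ F.mapIso e⟩

/-- A tensor equivalence is compatible with the forgetful functors to vector spaces, up to a
natural isomorphism which can be normalised on the unit object. -/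
theorem exists_natural_linearEquiv :
    ∃ η : ∀ X : FDRepr k H₁, X.V ≃ₗ[k] (F.obj X).V,
      (∀ {X Y : FDRepr k H₁} (f : X ⟶ Y) (x : X.V), η Y (f.lin x) = (F.map f).lin (η X x)) ∧
      ∀ c : k, η (𝟙_ (FDRepr k H₁)) c = (LaxMonoidal.ε F).lin c := by
  obtain ⟨θ⟩ := nonempty_regular_iso_obj_regular F
  -- The chain is `X ≃ Hom(H₁, X) ≃ Hom(F H₁, F X) ≃ Hom(H₂, F X) ≃ F X`, each step natural in `X`.
  let η (X : FDRepr k H₁) : X.V ≃ₗ[k] (F.obj X).V :=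
    (regularHomEquiv X).symm ≪≫ₗ mapHomEquiv F _ _ ≪≫ₗ
      Linear.homCongr k θ.symm (Iso.refl (F.obj X)) ≪≫ₗ regularHomEquiv (F.obj X)
  have hη {X Y : FDRepr k H₁} (f : X ⟶ Y) (x : X.V) :
      η Y (f.lin x) = (F.map f).lin (η X x) := by
    have h : (regularHomEquiv Y).symm (f.lin x) = (regularHomEquiv X).symm x ≫ f := by
      apply (regularHomEquiv Y).injective
      rw [LinearEquiv.apply_symm_apply]
      exact congrArg f.lin ((regularHomEquiv X).apply_symm_apply x).symm
    simp only [η, LinearEquiv.trans_apply, h]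
    simp [regularHomEquiv, Linear.homCongr]
  let ε := linEquivOfIso (Monoidal.εIso F)
  -- On the one-dimensional unit object `η` and `ε` differ by a scalar. Rescaling every `η X` by it
  -- keeps naturality and makes them agree.
  let c : k := (η (𝟙_ _)).symm (ε (1 : k))
  have hc : c ≠ 0 := fun h0 => one_ne_zero (α := k) <| by
    have := (LinearEquiv.map_eq_zero_iff _).1 h0
    exact (LinearEquiv.map_eq_zero_iff _).1 this
  refine ⟨fun X => LinearEquiv.smulOfNeZero k X.V c hc ≪≫ₗ η X, fun {X Y} f x => ?_, fun a => ?_⟩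
  · simp [hη]
  · have h1 : η (𝟙_ _) c = ε (1 : k) := LinearEquiv.apply_symm_apply _ _
    have h2 : c • a = a • c := mul_comm c a
    calc η (𝟙_ _) (c • a) = a • η (𝟙_ _) c := by rw [h2]; exact map_smul _ a c
      _ = ε (a • (1 : k)) := by rw [h1]; exact (map_smul ε a (1 : k)).symm
      _ = _ := by rw [smul_eq_mul, mul_one]; rfl

end TensorEquivalence

end FDRepr

/-! ### Faithfulness of the regular representation and natural endomorphisms -/

namespace FDRepr

section TwistAction

variable {k : Type u} {H : Type v} [Field k] [Ring H] [Algebra k H]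
variable {V W U : Type*} [AddCommGroup V] [Module k V] [AddCommGroup W] [Module k W]
  [AddCommGroup U] [Module k U]
  (ρ : H →ₐ[k] Module.End k V) (σ : H →ₐ[k] Module.End k W) (τ : H →ₐ[k] Module.End k U)

/-- With the three lemmas that follow, this identifies the actions on a triple tensor product of `(Δ
⊗ id)(J)`, `J ⊗ 1`, `(id ⊗ Δ)(J)` and `1 ⊗ J`, the factors of the twisted associator. -/
theorem assoc_comp_tensorAction_comp_left (Δ : H →ₐ[k] H ⊗[k] H) (x : H ⊗[k] H) :
    (TensorProduct.assoc k V W U).toLinearMap ∘ₗ tensorAction ((tensorAction ρ σ).comp Δ) τ x =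
      tensorAction ρ (tensorAction σ τ) (Algebra.TensorProduct.assoc k k k H H H
        (Algebra.TensorProduct.map Δ (AlgHom.id k H) x)) ∘ₗ
          (TensorProduct.assoc k V W U).toLinearMap := by
  rw [← tensorAction_assoc, tensorAction_map, AlgHom.comp_id]

theorem assoc_comp_map_tensorAction_left (x : H ⊗[k] H) :
    (TensorProduct.assoc k V W U).toLinearMap ∘ₗ
        TensorProduct.map (tensorAction ρ σ x) LinearMap.id =
      tensorAction ρ (tensorAction σ τ) (Algebra.TensorProduct.assoc k k k H H H
        (x ⊗ₜ[k] (1 : H))) ∘ₗ (TensorProduct.assoc k V W U).toLinearMap := by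
  rw [← tensorAction_assoc, tensorAction_tmul, map_one]
  rfl

theorem tensorAction_comp_right (Δ : H →ₐ[k] H ⊗[k] H) (x : H ⊗[k] H) :
    tensorAction ρ ((tensorAction σ τ).comp Δ) x =
      tensorAction ρ (tensorAction σ τ) (Algebra.TensorProduct.map (AlgHom.id k H) Δ x) := by
  rw [tensorAction_map, AlgHom.comp_id]

theorem map_tensorAction_right (x : H ⊗[k] H) :
    TensorProduct.map LinearMap.id (tensorAction σ τ x) =
      tensorAction ρ (tensorAction σ τ) ((1 : H) ⊗ₜ[k] x) := by
  rw [tensorAction_tmul, map_one]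
  rfl

theorem tensorAction_comp_comp_comp {H' : Type*} [Ring H'] [Algebra k H'] (φ : H' →ₐ[k] H)
    (x : H' ⊗[k] (H' ⊗[k] H')) :
    tensorAction (ρ.comp φ) (tensorAction (σ.comp φ) (τ.comp φ)) x =
      tensorAction ρ (tensorAction σ τ)
        (Algebra.TensorProduct.map φ (Algebra.TensorProduct.map φ φ) x) := by
  rw [tensorAction_map]
  congr 2
  exact AlgHom.ext fun y => (tensorAction_map σ τ φ φ y).symm

end TwistAction

section Faithful

variable (k : Type u) (H : Type v) [Field k] [Ring H] [Algebra k H] [FiniteDimensional k H]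

variable {k H} in
theorem regular_ρ_injective : Function.Injective (regular k H).ρ := fun a b h => by
  have := LinearMap.congr_fun h (regularEquiv k H 1)
  rwa [regular_ρ, regular_ρ, mul_one, mul_one, EmbeddingLike.apply_eq_iff_eq] at this

/-- Evaluation at `1 ⊗ 1` recovers the acting element, so `H ⊗ H` acts faithfully on the square of
the regular representation. -/
theorem tensorAction_regular_apply (x : H ⊗[k] H) :
    tensorAction (regular k H).ρ (regular k H).ρ x (regularEquiv k H 1 ⊗ₜ regularEquiv k H 1) =
      TensorProduct.congr (regularEquiv k H) (regularEquiv k H) x := by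
  induction x with
  | zero => simp
  | add x y hx hy => simp [hx, hy]
  | tmul a b => simp [regular_ρ]

theorem tensorAction_regular_regular_apply (x : H ⊗[k] (H ⊗[k] H)) :
    tensorAction (regular k H).ρ (tensorAction (regular k H).ρ (regular k H).ρ) x
        (regularEquiv k H 1 ⊗ₜ (regularEquiv k H 1 ⊗ₜ regularEquiv k H 1)) =
      TensorProduct.congr (regularEquiv k H)
        (TensorProduct.congr (regularEquiv k H) (regularEquiv k H)) x := by
  induction x with
  | zero => simp
  | add x y hx hy => simp only [map_add, LinearMap.add_apply, hx, hy]
  | tmul a b =>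
    rw [tensorAction_tmul, TensorProduct.map_tmul, tensorAction_regular_apply, regular_ρ, mul_one,
      TensorProduct.congr_tmul]

variable {k H}

theorem tensorAction_regular_injective :
    Function.Injective (tensorAction (regular k H).ρ (regular k H).ρ) := fun x y h => by
  have := LinearMap.congr_fun h (regularEquiv k H 1 ⊗ₜ regularEquiv k H 1)
  rwa [tensorAction_regular_apply, tensorAction_regular_apply, EmbeddingLike.apply_eq_iff_eq]
    at this

theorem tensorAction_regular_regular_injective :
    Function.Injective
      (tensorAction (regular k H).ρ (tensorAction (regular k H).ρ (regular k H).ρ)) :=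
  fun x y h => by
    have := LinearMap.congr_fun h
      (regularEquiv k H 1 ⊗ₜ (regularEquiv k H 1 ⊗ₜ regularEquiv k H 1))
    rwa [tensorAction_regular_regular_apply, tensorAction_regular_regular_apply,
      EmbeddingLike.apply_eq_iff_eq] at this

/-- Natural endomorphisms of the forgetful functor are given by elements of `H`. -/
theorem exists_ρ_eq_of_natural (T : ∀ X : FDRepr k H, X.V →ₗ[k] X.V)
    (hT : ∀ {X Y : FDRepr k H} (f : X ⟶ Y), T Y ∘ₗ f.lin = f.lin ∘ₗ T X) :
    ∃ a : H, ∀ X : FDRepr k H, T X = X.ρ a := by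
  -- Yoneda: the element is the value of `T` at `1` in the regular representation, and each `x` is
  -- the image of `1` under a morphism.
  refine ⟨(regularEquiv k H).symm (T _ (regularEquiv k H 1)), fun X => LinearMap.ext fun x => ?_⟩
  have := LinearMap.congr_fun (hT (regularDesc X x)) (regularEquiv k H 1)
  rw [LinearMap.comp_apply, LinearMap.comp_apply, regularDesc_lin, map_one,
    Module.End.one_apply] at this
  rw [this, ← regularDesc_lin, LinearEquiv.apply_symm_apply]

theorem map_regularDesc (X Y : FDRepr k H) (x : X.V) (y : Y.V) (a : H ⊗[k] H) :
    TensorProduct.map (regularDesc X x).lin (regularDesc Y y).lin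
        (TensorProduct.congr (regularEquiv k H) (regularEquiv k H) a) =
      tensorAction X.ρ Y.ρ a (x ⊗ₜ y) := by
  induction a with
  | zero => simp
  | add x y hx hy => simp only [map_add, LinearMap.add_apply, hx, hy]
  | tmul a b => simp [regularDesc_lin]

/-- Natural endomorphisms of the tensor square of the forgetful functor are given by elements of
`H ⊗ H`. -/
theorem exists_tensorAction_eq_of_natural
    (T : ∀ X Y : FDRepr k H, X.V ⊗[k] Y.V →ₗ[k] X.V ⊗[k] Y.V)
    (hT : ∀ {X Y X' Y' : FDRepr k H} (f : X ⟶ Y) (g : X' ⟶ Y'),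
      T Y Y' ∘ₗ TensorProduct.map f.lin g.lin = TensorProduct.map f.lin g.lin ∘ₗ T X X') :
    ∃ a : H ⊗[k] H, ∀ X Y : FDRepr k H, T X Y = tensorAction X.ρ Y.ρ a := by
  refine ⟨(TensorProduct.congr (regularEquiv k H) (regularEquiv k H)).symm
    (T _ _ (regularEquiv k H 1 ⊗ₜ regularEquiv k H 1)), fun X Y => TensorProduct.ext' fun x y => ?_⟩
  have := LinearMap.congr_fun (hT (regularDesc X x) (regularDesc Y y))
    (regularEquiv k H 1 ⊗ₜ regularEquiv k H 1)
  rw [LinearMap.comp_apply, LinearMap.comp_apply, TensorProduct.map_tmul, regularDesc_lin,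
    regularDesc_lin, map_one, map_one, Module.End.one_apply, Module.End.one_apply] at this
  rw [this, ← map_regularDesc, LinearEquiv.apply_symm_apply]

/-- Natural automorphisms of the tensor square of the forgetful functor are given by units of
`H ⊗ H`. -/
theorem exists_unit_tensorAction_eq_of_natural
    (T : ∀ X Y : FDRepr k H, X.V ⊗[k] Y.V ≃ₗ[k] X.V ⊗[k] Y.V)
    (hT : ∀ {X Y X' Y' : FDRepr k H} (f : X ⟶ Y) (g : X' ⟶ Y'),
      (T Y Y').toLinearMap ∘ₗ TensorProduct.map f.lin g.lin =
        TensorProduct.map f.lin g.lin ∘ₗ (T X X').toLinearMap) :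
    ∃ a : (H ⊗[k] H)ˣ, ∀ X Y : FDRepr k H, (T X Y).toLinearMap = tensorAction X.ρ Y.ρ ↑a := by
  obtain ⟨a, ha⟩ := exists_tensorAction_eq_of_natural (fun X Y => (T X Y).toLinearMap) hT
  -- The inverse family is natural as well, and the element it gives is inverse to `a` by
  -- faithfulness.
  obtain ⟨b, hb⟩ := exists_tensorAction_eq_of_natural (fun X Y => (T X Y).symm.toLinearMap)
    fun {X Y X' Y'} f g => by
      refine LinearMap.ext fun z => ?_
      obtain ⟨w, rfl⟩ := (T X X').surjective z
      have := LinearMap.congr_fun (hT f g) w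
      simp only [LinearMap.comp_apply, LinearEquiv.coe_coe] at this ⊢
      rw [← this, LinearEquiv.symm_apply_apply, LinearEquiv.symm_apply_apply]
  refine ⟨⟨a, b, tensorAction_regular_injective ?_, tensorAction_regular_injective ?_⟩, ha⟩
  · rw [map_mul, ← ha, ← hb, map_one]
    ext
    simp
  · rw [map_mul, ← ha, ← hb, map_one]
    ext
    simp

end Faithful

end FDRepr

/-! ### Reconstruction of the algebra map and the twist -/

namespace FDRepr

open MonoidalCategory QuasiBialgebra

/-- Clearing the inverses from the definition of `Φ^J` gives the form in which the associativity
axiom of a monoidal functor appears. -/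
theorem eq_twistAssoc_iff {k : Type u} {H : Type v} [Field k] [Ring H] [Algebra k H]
    [QuasiBialgebra k H] (J : (H ⊗[k] H)ˣ) (x : H ⊗[k] (H ⊗[k] H)) :
    x = twistAssoc J ↔
      Algebra.TensorProduct.map (AlgHom.id k H) (comul (k := k) (H := H)) (J : H ⊗[k] H) *
          ((1 : H) ⊗ₜ[k] (J : H ⊗[k] H)) * x =
        (assoc (k := k) (H := H) : H ⊗[k] (H ⊗[k] H)) *
          Algebra.TensorProduct.assoc k k k H H H
            (Algebra.TensorProduct.map (comul (k := k) (H := H)) (AlgHom.id k H)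
              (J : H ⊗[k] H)) *
          Algebra.TensorProduct.assoc k k k H H H ((J : H ⊗[k] H) ⊗ₜ[k] (1 : H)) := by
  let a := Units.map (Algebra.TensorProduct.map (AlgHom.id k H)
    (comul (k := k) (H := H))).toMonoidHom J
  let b := Units.map (Algebra.TensorProduct.includeRight :
    H ⊗[k] H →ₐ[k] H ⊗[k] (H ⊗[k] H)).toMonoidHom J
  have h : twistAssoc J = (↑(a * b)⁻¹ : H ⊗[k] (H ⊗[k] H)) *
      ((assoc (k := k) (H := H) : H ⊗[k] (H ⊗[k] H)) *
          Algebra.TensorProduct.assoc k k k H H H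
            (Algebra.TensorProduct.map (comul (k := k) (H := H)) (AlgHom.id k H)
              (J : H ⊗[k] H)) *
          Algebra.TensorProduct.assoc k k k H H H ((J : H ⊗[k] H) ⊗ₜ[k] (1 : H))) := by
    rw [mul_inv_rev, Units.val_mul, twistAssoc]
    simp only [mul_assoc]
    rfl
  rw [h, Units.eq_inv_mul_iff_mul_eq]
  rfl

section Tensorator

variable {k : Type u} {H₁ : Type v} {H₂ : Type w} [Field k]
  [Ring H₁] [Algebra k H₁] [QuasiBialgebra k H₁] [Ring H₂] [Algebra k H₂] [QuasiBialgebra k H₂]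
  (F : FDRepr k H₁ ⥤ FDRepr k H₂) [F.Monoidal]

/-- The tensorator of a monoidal functor as a linear equivalence. -/
noncomputable def muEquiv (X Y : FDRepr k H₁) :
    (F.obj X).V ⊗[k] (F.obj Y).V ≃ₗ[k] (F.obj (tensor X Y)).V :=
  linEquivOfIso (Functor.Monoidal.μIso F X Y)

/-- The unit constraint of a monoidal functor as a linear map. -/
noncomputable def epsLin : k →ₗ[k] (F.obj (unit : FDRepr k H₁)).V :=
  (Functor.LaxMonoidal.ε F).lin

theorem muEquiv_natural {X Y X' Y' : FDRepr k H₁} (f : X ⟶ Y) (g : X' ⟶ Y') :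
    (muEquiv F Y Y').toLinearMap ∘ₗ TensorProduct.map (F.map f).lin (F.map g).lin =
      (F.map (tensorMap f g)).lin ∘ₗ (muEquiv F X X').toLinearMap :=
  congrArg Hom.lin (Functor.LaxMonoidal.μ_natural F f g)

theorem muEquiv_comm (X Y : FDRepr k H₁) (h : H₂) :
    (muEquiv F X Y).toLinearMap ∘ₗ tensorAction (F.obj X).ρ (F.obj Y).ρ (comul (k := k) h) =
      (F.obj (tensor X Y)).ρ h ∘ₗ (muEquiv F X Y).toLinearMap :=
  (Functor.LaxMonoidal.μ F X Y).comm h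

theorem epsLin_comm (h : H₂) (c : k) :
    (F.obj (unit : FDRepr k H₁)).ρ h (epsLin F c) = epsLin F (counit (k := k) h * c) :=
  (lin_comm_apply (Functor.LaxMonoidal.ε F) h c).symm

theorem muEquiv_associativity (X Y Z : FDRepr k H₁) :
    (F.map (α_ X Y Z).hom).lin ∘ₗ (muEquiv F (tensor X Y) Z).toLinearMap ∘ₗ
        TensorProduct.map (muEquiv F X Y).toLinearMap LinearMap.id =
      (muEquiv F X (tensor Y Z)).toLinearMap ∘ₗ
        TensorProduct.map LinearMap.id (muEquiv F Y Z).toLinearMap ∘ₗ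
          (assocEquiv (F.obj X).ρ (F.obj Y).ρ (F.obj Z).ρ).toLinearMap :=
  congrArg Hom.lin (Functor.LaxMonoidal.associativity F X Y Z)

theorem muEquiv_left_unitality (X : FDRepr k H₁) (y : (F.obj X).V) :
    (F.map (λ_ X).hom).lin (muEquiv F unit X (epsLin F 1 ⊗ₜ y)) = y := by
  have := LinearMap.congr_fun (congrArg Hom.lin (Functor.LaxMonoidal.left_unitality F X))
    ((1 : k) ⊗ₜ[k] y)
  exact this.symm.trans ((TensorProduct.lid_tmul y (1 : k)).trans (one_smul k y))

theorem muEquiv_right_unitality (X : FDRepr k H₁) (y : (F.obj X).V) :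
    (F.map (ρ_ X).hom).lin (muEquiv F X unit (y ⊗ₜ epsLin F 1)) = y := by
  have := LinearMap.congr_fun (congrArg Hom.lin (Functor.LaxMonoidal.right_unitality F X))
    (y ⊗ₜ[k] (1 : k))
  exact this.symm.trans ((TensorProduct.rid_tmul y (1 : k)).trans (one_smul k y))

end Tensorator

section Reconstruction

variable {k : Type u} {H₁ : Type v} {H₂ : Type w} [Field k]
  [Ring H₁] [Algebra k H₁] [FiniteDimensional k H₁] [Ring H₂] [Algebra k H₂]
  {F : FDRepr k H₁ ⥤ FDRepr k H₂} {η : ∀ X : FDRepr k H₁, X.V ≃ₗ[k] (F.obj X).V}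

/-- A functor between categories of representations which is compatible with the forgetful functors
up to natural isomorphism is given by a homomorphism of algebras. -/
theorem exists_algHom_of_natural
    (hη : ∀ {X Y : FDRepr k H₁} (f : X ⟶ Y),
      (η Y).toLinearMap ∘ₗ f.lin = (F.map f).lin ∘ₗ (η X).toLinearMap) :
    ∃ φ : H₂ →ₐ[k] H₁, ∀ (X : FDRepr k H₁) (h : H₂),
      (η X).toLinearMap ∘ₗ X.ρ (φ h) = (F.obj X).ρ h ∘ₗ (η X).toLinearMap := by
  have key (h : H₂) : ∃ a : H₁, ∀ X : FDRepr k H₁,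
      (η X).symm.toLinearMap ∘ₗ (F.obj X).ρ h ∘ₗ (η X).toLinearMap = X.ρ a :=
    exists_ρ_eq_of_natural _ fun {X Y} f => LinearMap.ext fun x => by
      have h1 := LinearMap.congr_fun (hη f)
      simp only [LinearMap.comp_apply, LinearEquiv.coe_coe] at h1 ⊢
      rw [LinearEquiv.symm_apply_eq, h1, h1, LinearEquiv.apply_symm_apply, lin_comm_apply]
  choose φ hφ using key
  -- The action of `H₂` on `F` of the regular representation, conjugated by `η`, is already an
  -- algebra map. Faithfulness of the regular representation transfers this to `φ`.
  let ψ : H₂ →ₐ[k] Module.End k (regular k H₁).V :=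
    ((η (regular k H₁)).symm.conjAlgEquiv k).toAlgHom.comp (F.obj (regular k H₁)).ρ
  have hψ (h : H₂) : ψ h = (regular k H₁).ρ (φ h) := hφ h _
  refine ⟨AlgHom.ofLinearMap
    { toFun := φ
      map_add' a b := regular_ρ_injective (k := k) (by simp only [map_add, ← hψ])
      map_smul' c a := regular_ρ_injective (k := k) (by simp only [map_smul, ← hψ, RingHom.id_apply]) }
    (regular_ρ_injective (k := k) (by
      rw [LinearMap.coe_mk, AddHom.coe_mk, ← hψ, map_one, map_one]))
    fun a b => regular_ρ_injective (k := k) (by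
      simp only [LinearMap.coe_mk, AddHom.coe_mk]
      rw [map_mul, ← hψ, ← hψ, ← hψ, map_mul]), fun X h => ?_⟩
  rw [AlgHom.ofLinearMap_apply, LinearMap.coe_mk, AddHom.coe_mk, ← hφ]
  ext x
  simp

variable [QuasiBialgebra k H₁] [QuasiBialgebra k H₂] [F.Monoidal]

/-- A monoidal structure on a functor compatible with the forgetful functors is given by a unit of
`H ⊗ H`. -/
theorem exists_unit_tensorator
    (hη : ∀ {X Y : FDRepr k H₁} (f : X ⟶ Y),
      (η Y).toLinearMap ∘ₗ f.lin = (F.map f).lin ∘ₗ (η X).toLinearMap) :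
    ∃ J : (H₁ ⊗[k] H₁)ˣ, ∀ X Y : FDRepr k H₁,
      (muEquiv F X Y).toLinearMap ∘ₗ TensorProduct.map (η X).toLinearMap (η Y).toLinearMap =
        (η (tensor X Y)).toLinearMap ∘ₗ tensorAction X.ρ Y.ρ ↑J := by
  -- `J` measures the failure of `η` to be monoidal: it represents `η⁻¹ ∘ μ ∘ (η ⊗ η)`.
  obtain ⟨J, hJ⟩ := exists_unit_tensorAction_eq_of_natural
    (fun X Y : FDRepr k H₁ => TensorProduct.congr (η X) (η Y) ≪≫ₗ muEquiv F X Y ≪≫ₗ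
      (η (tensor X Y)).symm)
    fun {X Y X' Y'} f g => by
      refine TensorProduct.ext' fun x x' => ?_
      have h1 := LinearMap.congr_fun (hη f) x
      have h2 := LinearMap.congr_fun (hη g) x'
      have h3 := LinearMap.congr_fun (hη (tensorMap f g))
        ((η (tensor X X')).symm (muEquiv F X X' (η X x ⊗ₜ η X' x')))
      have h4 := LinearMap.congr_fun (muEquiv_natural F f g) (η X x ⊗ₜ η X' x')
      simp only [LinearMap.comp_apply, LinearEquiv.coe_coe, TensorProduct.map_tmul,
        LinearEquiv.trans_apply, TensorProduct.congr_tmul,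
        LinearEquiv.apply_symm_apply] at h1 h2 h3 h4 ⊢
      rw [LinearEquiv.symm_apply_eq, h1, h2, h4]
      exact h3.symm
  refine ⟨J, fun X Y => ?_⟩
  rw [← hJ]
  refine TensorProduct.ext' fun x y => ?_
  simp

variable {φ : H₂ →ₐ[k] H₁} {J : (H₁ ⊗[k] H₁)ˣ}

/-- This is the `H₂`-equivariance of the tensorator on the square of the regular representation,
carried through `η` and written as `J · (φ ⊗ φ)(Δ h) = Δ(φ h) · J`. -/
theorem map_comul_eq_twistComul
    (hφ : ∀ (X : FDRepr k H₁) (h : H₂),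
      (η X).toLinearMap ∘ₗ X.ρ (φ h) = (F.obj X).ρ h ∘ₗ (η X).toLinearMap)
    (hJ : ∀ X Y : FDRepr k H₁,
      (muEquiv F X Y).toLinearMap ∘ₗ TensorProduct.map (η X).toLinearMap (η Y).toLinearMap =
        (η (tensor X Y)).toLinearMap ∘ₗ tensorAction X.ρ Y.ρ ↑J) (h : H₂) :
    Algebra.TensorProduct.map φ φ (comul (k := k) h) = twistComul J (φ h) := by
  rw [twistComul, mul_assoc, Units.eq_inv_mul_iff_mul_eq]
  apply tensorAction_regular_injective
  set R := regular k H₁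
  have hinj : Function.Injective (η (tensor R R)).toLinearMap := (η (tensor R R)).injective
  rw [← LinearMap.cancel_left hinj, map_mul, map_mul, Module.End.mul_eq_comp,
    Module.End.mul_eq_comp, ← LinearMap.comp_assoc, ← hJ, tensorAction_map, LinearMap.comp_assoc,
    map_comp_tensorAction (ρ' := (F.obj R).ρ) (σ' := (F.obj R).ρ) _ _ (hφ R) (hφ R),
    ← LinearMap.comp_assoc, muEquiv_comm, LinearMap.comp_assoc, hJ, ← LinearMap.comp_assoc,
    ← hφ]
  rfl

-- The normalisation of `η` makes it equal to the unit constraint of `F` on the unit object, and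
-- that constraint is equivariant.
omit [FiniteDimensional k H₁] in
theorem counit_comp_eq
    (hφ : ∀ (X : FDRepr k H₁) (h : H₂),
      (η X).toLinearMap ∘ₗ X.ρ (φ h) = (F.obj X).ρ h ∘ₗ (η X).toLinearMap)
    (hε : ∀ c : k, η unit c = epsLin F c) (h : H₂) :
    counit (k := k) (φ h) = counit (k := k) h := by
  have h1 : η (unit : FDRepr k H₁) (counit (k := k) (φ h) * (1 : k)) =
      (F.obj (unit : FDRepr k H₁)).ρ h (η (unit : FDRepr k H₁) (1 : k)) :=
    LinearMap.congr_fun (hφ unit h) (1 : k)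
  rw [hε 1, epsLin_comm, ← hε, mul_one, mul_one] at h1
  exact (η unit).injective h1

/-- Unitality of `F` at the regular representation, together with the normalisation of `η`, shows
that `(ε ⊗ id)(J)` and `(id ⊗ ε)(J)` act there as the identity. Faithfulness concludes. -/
theorem isTwist_of_tensorator
    (hη : ∀ {X Y : FDRepr k H₁} (f : X ⟶ Y),
      (η Y).toLinearMap ∘ₗ f.lin = (F.map f).lin ∘ₗ (η X).toLinearMap)
    (hJ : ∀ X Y : FDRepr k H₁,
      (muEquiv F X Y).toLinearMap ∘ₗ TensorProduct.map (η X).toLinearMap (η Y).toLinearMap =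
        (η (tensor X Y)).toLinearMap ∘ₗ tensorAction X.ρ Y.ρ ↑J)
    (hε : ∀ c : k, η unit c = epsLin F c) : IsTwist k J := by
  set R := regular k H₁
  constructor
  · apply regular_ρ_injective (k := k)
    rw [map_one]
    refine LinearMap.ext fun x => (η R).injective ?_
    have h1 := LinearMap.congr_fun (hJ unit R) ((1 : k) ⊗ₜ x)
    have h2 := LinearMap.congr_fun (lid_comp_tensorAction counit R.ρ (J : H₁ ⊗[k] H₁))
      ((1 : k) ⊗ₜ x)
    have h3 := LinearMap.congr_fun (hη (λ_ R).hom)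
      (tensorAction (unit : FDRepr k H₁).ρ R.ρ ↑J ((1 : k) ⊗ₜ x))
    have h4 := muEquiv_left_unitality F R (η R x)
    simp only [LinearMap.comp_apply, LinearEquiv.coe_coe, TensorProduct.map_tmul,
      TensorProduct.lid_tmul, one_smul] at h1 h2 h3
    rw [hε 1] at h1
    rw [h1] at h4
    rw [← h2, Module.End.one_apply]
    exact h3.trans h4
  · apply regular_ρ_injective (k := k)
    rw [map_one]
    refine LinearMap.ext fun x => (η R).injective ?_
    have h1 := LinearMap.congr_fun (hJ R unit) (x ⊗ₜ (1 : k))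
    have h2 := LinearMap.congr_fun (rid_comp_tensorAction counit R.ρ (J : H₁ ⊗[k] H₁))
      (x ⊗ₜ (1 : k))
    have h3 := LinearMap.congr_fun (hη (ρ_ R).hom)
      (tensorAction R.ρ (unit : FDRepr k H₁).ρ ↑J (x ⊗ₜ (1 : k)))
    have h4 := muEquiv_right_unitality F R (η R x)
    simp only [LinearMap.comp_apply, LinearEquiv.coe_coe, TensorProduct.map_tmul,
      TensorProduct.rid_tmul, one_smul] at h1 h2 h3
    rw [hε 1] at h1
    rw [h1] at h4
    rw [← h2, Module.End.one_apply]
    exact h3.trans h4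

theorem map_assoc_eq_twistAssoc
    (hη : ∀ {X Y : FDRepr k H₁} (f : X ⟶ Y),
      (η Y).toLinearMap ∘ₗ f.lin = (F.map f).lin ∘ₗ (η X).toLinearMap)
    (hφ : ∀ (X : FDRepr k H₁) (h : H₂),
      (η X).toLinearMap ∘ₗ X.ρ (φ h) = (F.obj X).ρ h ∘ₗ (η X).toLinearMap)
    (hJ : ∀ X Y : FDRepr k H₁,
      (muEquiv F X Y).toLinearMap ∘ₗ TensorProduct.map (η X).toLinearMap (η Y).toLinearMap =
        (η (tensor X Y)).toLinearMap ∘ₗ tensorAction X.ρ Y.ρ ↑J) :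
    Algebra.TensorProduct.map φ (Algebra.TensorProduct.map φ φ)
      (assoc (k := k) (H := H₂) : H₂ ⊗[k] (H₂ ⊗[k] H₂)) = twistAssoc J := by
  rw [eq_twistAssoc_iff]
  apply tensorAction_regular_regular_injective
  set R := regular k H₁
  let S := tensorAction R.ρ (tensorAction R.ρ R.ρ)
  have hJ' (X Y : FDRepr k H₁) (z : X.V ⊗[k] Y.V) : muEquiv F X Y (TensorProduct.map
      (η X).toLinearMap (η Y).toLinearMap z) = η (tensor X Y) (tensorAction X.ρ Y.ρ ↑J z) :=
    LinearMap.congr_fun (hJ X Y) z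
  have hα (z) : η (tensor R (tensor R R)) (S (assoc (k := k) (H := H₁) : H₁ ⊗[k] (H₁ ⊗[k] H₁))
      (TensorProduct.assoc k R.V R.V R.V z)) =
        (F.map (α_ R R R).hom).lin (η (tensor (tensor R R) R) z) :=
    LinearMap.congr_fun (hη (α_ R R R).hom) z
  have hF (z) : (F.map (α_ R R R).hom).lin (muEquiv F (tensor R R) R
      (TensorProduct.map (muEquiv F R R).toLinearMap LinearMap.id z)) =
      muEquiv F R (tensor R R) (TensorProduct.map LinearMap.id (muEquiv F R R).toLinearMap
        (assocEquiv (F.obj R).ρ (F.obj R).ρ (F.obj R).ρ z)) :=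
    LinearMap.congr_fun (muEquiv_associativity F R R R) z
  have e₁ (z) : TensorProduct.map (muEquiv F R R).toLinearMap LinearMap.id (TensorProduct.map
      (TensorProduct.map (η R).toLinearMap (η R).toLinearMap) (η R).toLinearMap z) =
      TensorProduct.map (η (tensor R R)).toLinearMap (η R).toLinearMap
        (TensorProduct.map (tensorAction R.ρ R.ρ ↑J) LinearMap.id z) := by
    rw [← LinearMap.comp_apply, ← LinearMap.comp_apply, ← TensorProduct.map_comp,
      ← TensorProduct.map_comp, hJ]
    rfl
  have e₂ (z) : TensorProduct.map LinearMap.id (muEquiv F R R).toLinearMap (TensorProduct.map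
      (η R).toLinearMap (TensorProduct.map (η R).toLinearMap (η R).toLinearMap) z) =
      TensorProduct.map (η R).toLinearMap (η (tensor R R)).toLinearMap
        (TensorProduct.map LinearMap.id (tensorAction R.ρ R.ρ ↑J) z) := by
    rw [← LinearMap.comp_apply, ← LinearMap.comp_apply, ← TensorProduct.map_comp,
      ← TensorProduct.map_comp, hJ]
    rfl
  have e₃ (z) : assocEquiv (F.obj R).ρ (F.obj R).ρ (F.obj R).ρ (TensorProduct.map
      (TensorProduct.map (η R).toLinearMap (η R).toLinearMap) (η R).toLinearMap z) =
      TensorProduct.map (η R).toLinearMap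
        (TensorProduct.map (η R).toLinearMap (η R).toLinearMap)
        (S (Algebra.TensorProduct.map φ (Algebra.TensorProduct.map φ φ)
          (assoc (k := k) (H := H₂) : H₂ ⊗[k] (H₂ ⊗[k] H₂)))
          (TensorProduct.assoc k R.V R.V R.V z)) := by
    have hR (h : H₂) : (η R).toLinearMap ∘ₗ (R.ρ.comp φ) h =
        (F.obj R).ρ h ∘ₗ (η R).toLinearMap := hφ R h
    have h1 := LinearMap.congr_fun (map_comp_tensorAction _ _ hR (map_comp_tensorAction _ _ hR hR)
      (assoc (k := k) (H := H₂) : H₂ ⊗[k] (H₂ ⊗[k] H₂))) (TensorProduct.assoc k R.V R.V R.V z)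
    have h2 : TensorProduct.assoc k _ _ _ (TensorProduct.map
        (TensorProduct.map (η R).toLinearMap (η R).toLinearMap) (η R).toLinearMap z) =
        TensorProduct.map (η R).toLinearMap (TensorProduct.map (η R).toLinearMap
          (η R).toLinearMap) (TensorProduct.assoc k R.V R.V R.V z) :=
      LinearMap.congr_fun (TensorProduct.map_map_comp_assoc_eq (η R).toLinearMap
        (η R).toLinearMap (η R).toLinearMap).symm z
    rw [← tensorAction_comp_comp_comp]
    refine Eq.trans ?_ h1.symm
    rw [LinearMap.comp_apply, ← h2]
    rfl
  have e₄ (z) : S (Algebra.TensorProduct.map (AlgHom.id k H₁) (comul (k := k) (H := H₁)) ↑J) z =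
      tensorAction R.ρ (tensor R R).ρ ↑J z :=
    (LinearMap.congr_fun (tensorAction_comp_right R.ρ R.ρ R.ρ comul _) z).symm
  have e₅ (z) : S ((1 : H₁) ⊗ₜ[k] ↑J) z =
      TensorProduct.map LinearMap.id (tensorAction R.ρ R.ρ ↑J) z :=
    (LinearMap.congr_fun (map_tensorAction_right R.ρ R.ρ R.ρ _) z).symm
  have e₆ (z) : S (Algebra.TensorProduct.assoc k k k H₁ H₁ H₁ (Algebra.TensorProduct.map
      (comul (k := k) (H := H₁)) (AlgHom.id k H₁) ↑J)) (TensorProduct.assoc k R.V R.V R.V z) =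
      TensorProduct.assoc k R.V R.V R.V (tensorAction (tensor R R).ρ R.ρ ↑J z) :=
    (LinearMap.congr_fun (assoc_comp_tensorAction_comp_left R.ρ R.ρ R.ρ comul _) z).symm
  have e₇ (z) : S (Algebra.TensorProduct.assoc k k k H₁ H₁ H₁ (↑J ⊗ₜ[k] (1 : H₁)))
      (TensorProduct.assoc k R.V R.V R.V z) = TensorProduct.assoc k R.V R.V R.V
        (TensorProduct.map (tensorAction R.ρ R.ρ ↑J) LinearMap.id z) :=
    (LinearMap.congr_fun (assoc_comp_map_tensorAction_left R.ρ R.ρ R.ρ _) z).symm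
  refine LinearMap.ext fun y => ?_
  obtain ⟨z, rfl⟩ := (TensorProduct.assoc k R.V R.V R.V).surjective y
  apply (η (tensor R (tensor R R))).injective
  change η (tensor R (tensor R R)) (S _ _) = η (tensor R (tensor R R)) (S _ _)
  rw [map_mul, map_mul, map_mul, map_mul]
  simp only [Module.End.mul_apply]
  -- On the right-hand side, `η` turns `Φ` into `F(α)` and both copies of `J` into tensorators.
  -- Associativity of `F` then applies, and undoing the conversion on the other side of the diagram
  -- produces the left-hand side.
  rw [e₇, e₆, hα, ← hJ', ← e₁, hF, e₃, e₂, hJ', e₄, e₅]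

end Reconstruction

end FDRepr

/-! ### From a twist to a monoidal equivalence -/

namespace FDRepr

open MonoidalCategory QuasiBialgebra

section Restriction

variable {k : Type u} {H₁ : Type v} {H₂ : Type w} [Field k]
  [Ring H₁] [Algebra k H₁] [Ring H₂] [Algebra k H₂]

/-- Restriction of representations along a homomorphism of algebras. -/
@[simps]
def restrict (φ : H₂ →ₐ[k] H₁) : FDRepr k H₁ ⥤ FDRepr k H₂ where
  obj X := { V := X.V, ρ := X.ρ.comp φ }
  map f := ⟨f.lin, fun h => f.comm (φ h)⟩

instance (φ : H₂ →ₐ[k] H₁) : (restrict φ).Additive where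

instance (φ : H₂ →ₐ[k] H₁) : (restrict φ).Linear k where

theorem restrict_isEquivalence (φ : H₂ ≃ₐ[k] H₁) :
    (restrict (φ : H₂ →ₐ[k] H₁)).IsEquivalence where
  faithful := ⟨fun {X Y f g} h => hom_ext <|
    show ((restrict (φ : H₂ →ₐ[k] H₁)).map f).lin = ((restrict (φ : H₂ →ₐ[k] H₁)).map g).lin by
      rw [h]⟩
  full := ⟨fun {X Y} f => ⟨⟨f.lin, fun h => by
    have := f.comm (φ.symm h)
    change f.lin ∘ₗ X.ρ (φ (φ.symm h)) = Y.ρ (φ (φ.symm h)) ∘ₗ f.lin at this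
    rwa [φ.apply_symm_apply] at this⟩, rfl⟩⟩
  essSurj := ⟨fun Y => ⟨(restrict (φ.symm : H₁ →ₐ[k] H₂)).obj Y,
    ⟨mkIso (LinearEquiv.refl k Y.V) fun h => LinearMap.ext fun y =>
      congrArg (fun a => Y.ρ a y) (φ.symm_apply_apply h)⟩⟩⟩

/-- The action of a unit of `H ⊗ H` as a linear equivalence. -/
noncomputable def tensorActionEquiv (J : (H₁ ⊗[k] H₁)ˣ) (X Y : FDRepr k H₁) :
    X.V ⊗[k] Y.V ≃ₗ[k] X.V ⊗[k] Y.V :=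
  LinearEquiv.ofLinearMap (tensorAction X.ρ Y.ρ ↑J) (tensorAction X.ρ Y.ρ ↑J⁻¹)
    (by rw [← Module.End.mul_eq_comp, ← map_mul, Units.mul_inv, map_one]; rfl)
    (by rw [← Module.End.mul_eq_comp, ← map_mul, Units.inv_mul, map_one]; rfl)

variable [QuasiBialgebra k H₁] [QuasiBialgebra k H₂]

theorem tensorActionEquiv_comm {φ : H₂ →ₐ[k] H₁} {J : (H₁ ⊗[k] H₁)ˣ}
    (hΔ : ∀ h : H₂, Algebra.TensorProduct.map φ φ (comul (k := k) h) = twistComul J (φ h))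
    (X Y : FDRepr k H₁) (h : H₂) :
    (tensorActionEquiv J X Y).toLinearMap ∘ₗ
        (tensor ((restrict φ).obj X) ((restrict φ).obj Y)).ρ h =
      ((restrict φ).obj (tensor X Y)).ρ h ∘ₗ (tensorActionEquiv J X Y).toLinearMap := by
  have := hΔ h
  rw [twistComul, mul_assoc, Units.eq_inv_mul_iff_mul_eq] at this
  have := congrArg (tensorAction X.ρ Y.ρ) this
  rw [map_mul, map_mul, tensorAction_map] at this
  exact this

/-- Restriction along an isomorphism with a twist is a monoidal functor. -/
noncomputable def restrictCoreMonoidal {φ : H₂ →ₐ[k] H₁} {J : (H₁ ⊗[k] H₁)ˣ} (hJ : IsTwist k J)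
    (hΔ : ∀ h : H₂, Algebra.TensorProduct.map φ φ (comul (k := k) h) = twistComul J (φ h))
    (hε : ∀ h : H₂, counit (k := k) (φ h) = counit (k := k) h)
    (hΦ : Algebra.TensorProduct.map φ (Algebra.TensorProduct.map φ φ)
      (assoc (k := k) (H := H₂) : H₂ ⊗[k] (H₂ ⊗[k] H₂)) = twistAssoc J) :
    (restrict φ).CoreMonoidal where
  εIso := mkIso (X := unit) (Y := (restrict φ).obj unit) (LinearEquiv.refl k k) fun h =>
    LinearMap.ext fun c => (congrArg (fun a => algebraMap k (Module.End k k) a c) (hε h)).symm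
  μIso X Y := mkIso (X := tensor ((restrict φ).obj X) ((restrict φ).obj Y))
    (Y := (restrict φ).obj (tensor X Y)) (tensorActionEquiv J X Y) (tensorActionEquiv_comm hΔ X Y)
  μIso_hom_natural_left f X' :=
    hom_ext (map_comp_tensorAction f.lin (𝟙 X' : X' ⟶ X').lin f.comm (𝟙 X' : X' ⟶ X').comm _).symm
  μIso_hom_natural_right X' f :=
    hom_ext (map_comp_tensorAction (𝟙 X' : X' ⟶ X').lin f.lin (𝟙 X' : X' ⟶ X').comm f.comm _).symm
  associativity X Y Z := by
    apply hom_ext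
    let S := tensorAction X.ρ (tensorAction Y.ρ Z.ρ)
    -- The formula for the twisted associator with inverses cleared, acting on `X ⊗ (Y ⊗ Z)`, is the
    -- associativity diagram once each factor is rewritten as a map of representation spaces.
    have h := congrArg S ((eq_twistAssoc_iff J _).1 hΦ)
    rw [map_mul, map_mul, map_mul, map_mul] at h
    have e₁ := assoc_comp_tensorAction_comp_left X.ρ Y.ρ Z.ρ comul (J : H₁ ⊗[k] H₁)
    have e₂ := assoc_comp_map_tensorAction_left X.ρ Y.ρ Z.ρ (J : H₁ ⊗[k] H₁)
    have e₃ := tensorAction_comp_right X.ρ Y.ρ Z.ρ comul (J : H₁ ⊗[k] H₁)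
    have e₄ := map_tensorAction_right X.ρ Y.ρ Z.ρ (J : H₁ ⊗[k] H₁)
    have e₅ := tensorAction_comp_comp_comp X.ρ Y.ρ Z.ρ φ
      (assoc (k := k) (H := H₂) : H₂ ⊗[k] (H₂ ⊗[k] H₂))
    refine LinearMap.ext fun (z : (X.V ⊗[k] Y.V) ⊗[k] Z.V) => ?_
    have h := LinearMap.congr_fun h (TensorProduct.assoc k X.V Y.V Z.V z)
    have e₁ := LinearMap.congr_fun e₁
      (TensorProduct.map (tensorAction X.ρ Y.ρ ↑J) LinearMap.id z)
    have e₂ := LinearMap.congr_fun e₂ z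
    simp only [LinearMap.comp_apply, LinearEquiv.coe_coe, Module.End.mul_apply] at h e₁ e₂
    dsimp only [S] at h
    rw [← e₂, ← e₁, ← e₃, ← e₄, ← e₅] at h
    exact h.symm
  left_unitality X := by
    apply hom_ext
    refine LinearMap.ext fun z => ?_
    have := LinearMap.congr_fun (lid_comp_tensorAction counit X.ρ (J : H₁ ⊗[k] H₁)) z
    rw [hJ.1, map_one] at this
    refine this.symm.trans ?_
    change _ = TensorProduct.lid k X.V (tensorAction (unit : FDRepr k H₁).ρ X.ρ ↑J
      (TensorProduct.map LinearMap.id LinearMap.id z))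
    rw [TensorProduct.map_id]
    rfl
  right_unitality X := by
    apply hom_ext
    refine LinearMap.ext fun z => ?_
    have := LinearMap.congr_fun (rid_comp_tensorAction counit X.ρ (J : H₁ ⊗[k] H₁)) z
    rw [hJ.2, map_one] at this
    refine this.symm.trans ?_
    change _ = TensorProduct.rid k X.V (tensorAction X.ρ (unit : FDRepr k H₁).ρ ↑J
      (TensorProduct.map LinearMap.id LinearMap.id z))
    rw [TensorProduct.map_id]
    rfl

end Restriction

end FDRepr

/-! ### The two implications -/

namespace QuasiBialgebra

variable {k : Type u} {H₁ : Type v} {H₂ : Type w} [Field k]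
  [Ring H₁] [Algebra k H₁] [QuasiBialgebra k H₁] [Ring H₂] [Algebra k H₂] [QuasiBialgebra k H₂]

theorem TwistEquivalent.tensorEquivalentRep (h : TwistEquivalent k H₁ H₂) :
    TensorEquivalentRep k H₁ H₂ := by
  obtain ⟨J, φ, hJ, hΔ, hε, hΦ⟩ := h
  exact ⟨FDRepr.restrict (φ : H₂ →ₐ[k] H₁), FDRepr.restrict_isEquivalence φ, inferInstance,
    inferInstance, ⟨(FDRepr.restrictCoreMonoidal hJ hΔ hε hΦ).toMonoidal⟩⟩

variable [FiniteDimensional k H₁] [FiniteDimensional k H₂]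

theorem _root_.TensorEquivalentRep.twistEquivalent (h : TensorEquivalentRep k H₁ H₂) :
    TwistEquivalent k H₁ H₂ := by
  obtain ⟨F, _, _, _, ⟨_⟩⟩ := h
  obtain ⟨η, hη, hε⟩ := FDRepr.exists_natural_linearEquiv F
  have hη {X Y : FDRepr k H₁} (f : X ⟶ Y) :
      (η Y).toLinearMap ∘ₗ f.lin = (F.map f).lin ∘ₗ (η X).toLinearMap :=
    LinearMap.ext (hη f)
  obtain ⟨φ, hφ⟩ := FDRepr.exists_algHom_of_natural hη
  obtain ⟨J, hJ⟩ := FDRepr.exists_unit_tensorator hη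
  obtain ⟨θ⟩ := FDRepr.nonempty_regular_iso_obj_regular F
  -- An element killed by `φ` acts as zero on `F` of the regular representation of `H₁`. That object
  -- is isomorphic to the regular representation of `H₂`, which is faithful.
  have hinj : Function.Injective φ := by
    rw [injective_iff_map_eq_zero]
    intro a ha
    apply FDRepr.regular_ρ_injective (k := k)
    refine LinearMap.ext fun x => (FDRepr.linEquivOfIso θ).injective ?_
    obtain ⟨y, hy⟩ := (η (FDRepr.regular k H₁)).surjective (FDRepr.linEquivOfIso θ x)
    have h1 := LinearMap.congr_fun (hφ (FDRepr.regular k H₁) a) y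
    rw [ha, map_zero] at h1
    simp only [LinearMap.comp_apply, LinearEquiv.coe_coe, LinearMap.zero_apply, map_zero] at h1
    rw [map_zero, LinearMap.zero_apply, map_zero]
    refine (FDRepr.lin_comm_apply θ.hom a x).trans ?_
    rw [h1]
    exact congrArg _ hy.symm
  -- Preservation of dimension, applied to the regular representation, upgrades injectivity of `φ`
  -- to bijectivity.
  have hdim : Module.finrank k H₂ = Module.finrank k H₁ := by
    rw [(FDRepr.regularEquiv k H₂).finrank_eq, (FDRepr.regularEquiv k H₁).finrank_eq,
      (FDRepr.linEquivOfIso θ).finrank_eq, FDRepr.finrank_obj_of_tensorEquivalence]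
  have hbij : Function.Bijective φ :=
    ⟨hinj, (LinearMap.injective_iff_surjective_of_finrank_eq_finrank
      (f := φ.toLinearMap) hdim).1 hinj⟩
  exact ⟨J, AlgEquiv.ofBijective φ hbij, FDRepr.isTwist_of_tensorator hη hJ hε,
    FDRepr.map_comul_eq_twistComul hφ hJ, FDRepr.counit_comp_eq hφ hε,
    FDRepr.map_assoc_eq_twistAssoc hη hφ hJ⟩

end QuasiBialgebra

theorem theorem6p1 {H₁ H₂ : Type*}
    [Ring H₁] [Algebra ℂ H₁] [FiniteDimensional ℂ H₁] [QuasiBialgebra ℂ H₁]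
    [Ring H₂] [Algebra ℂ H₂] [FiniteDimensional ℂ H₂] [QuasiBialgebra ℂ H₂] :
    QuasiBialgebra.TwistEquivalent ℂ H₁ H₂ ↔ TensorEquivalentRep ℂ H₁ H₂ :=
  ⟨fun h => h.tensorEquivalentRep, fun h => h.twistEquivalent⟩
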